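/- Let $a>-1$ and $\theta>0$. For $N\ge 0$ put \[ Z_N^{B}=\frac1{N!}\int_{\mathbb R_+^N}\prod_{1\le j<k\le N}\frac{x_k-x_j}{x_k+x_j}\,(x_k^\theta-x_j^\theta)\prod_{j=1}^N x_j^a e^{-x_j}\,dx_j , \] \[ Z_N^{C}=\frac1{(N!)^2}\int_{\mathbb R_+^N\times\mathbb R_+^N}\prod_{j=1}^N x_j^a e^{-x_j}y_j^{a+1}e^{-y_j}\, \frac{\prod_{j<k}(x_k-x_j)(y_k-y_j)}{\prod_{j,k=1}^N(x_j+y_k)}\prod_{j<k}(x_k^\theta-x_j^\theta)(y_k^\theta-y_j^\theta)\,d[x]\,d[y], \] so $Z_0^B=Z_0^C=1$. For $j,k\ge 0$ let \[ I^C_{j,k}=\int_{\mathbb R_+^2}\frac{x^{j\theta+a}y^{k\theta+a+1}}{x+y}e^{-(x+y)}\,dx\,dy,\qquad i^B_j=\int_{\mathbb R_+}x^{j\theta+a}e^{-x}\,dx . \] The monic $\theta$-Cauchy bi-orthogonal polynomials are \[ \tilde P_n(x)=\frac1{Z_n^C}\det\bigl(I^C_{j,k}\;\; x^j\bigr)_{\substack{j=0,\dots,n\\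 k=0,\dots,n-1}},\qquad \tilde Q_n(y)=\frac1{Z_n^C}\det\begin{pmatrix}I^C_{j,k}\\ y^k\end{pmatrix}_{\substack{j=0,\dots,n-1\\ k=0,\dots,n}} , \] where $x^j$ forms the last column and $y^k$ the last row, respectively. For real polynomials $p,q$ let \[ \langle p,q\rangle_{B}=\int_{\mathbb R_+^2}\frac{y-x}{y+x}\,p(x^\theta)\,q(y^\theta)\,x^a y^a e^{-(x+y)}\,dx\,dy . \] There is exactly one sequence $(\phi_n)_{n\ge0}$ of real polynomials (the $\theta$-Bures, or partial-skew-orthogonal, polynomials) such that $\phi_n$ is monic of degree $n$ and, for all $n\ge 0$ and $0\le i\le 2n+1$, \[ \langle \phi_{2n},z^i\rangle_B=\frac{Z^B_{2n+2}}{Z^B_{2n}}\,\delta_{i,2n+1},\qquad \langle \phi_{2n+1},z^i\rangle_B=-\frac{Z^B_{2n+2}}{Z^B_{2n+1}}\,i^B_i , \] and the following identities of polynomials hold: \begin{enumerate} \item $\tilde P_n(x)+\tilde Q_n(x)=2\phi_n(x)$ for all $n\ge 0$; \item $\tilde Q_n(x)=\phi_n(x)-\dfrac{Z_{n+1}^BZ_{n-1}^B}{(Z_n^B)^2}\,\phi_{n-1}(x)$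 for all $n\ge1$; \item $\tilde P_n(x)=\phi_n(x)+\dfrac{Z_{n+1}^BZ_{n-1}^B}{(Z_n^B)^2}\,\phi_{n-1}(x)$ for all $n\ge1$. \end{enumerate} -/

import Mathlib

open Polynomial MeasureTheory

noncomputable section

namespace ThetaDeformed

/-- The open positive orthant of `ℝ^N`. -/
def orthant (N : ℕ) : Set (Fin N → ℝ) := {x | ∀ i, 0 < x i}

/-- The partition function of the `θ`-deformed Cauchy--Laguerre two-matrix model. -/
def cauchyPartition (a b θ : ℝ) (N : ℕ) : ℝ :=
  (1 / (N.factorial : ℝ)) ^ 2 *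
    ∫ z in orthant N ×ˢ orthant N,
      (∏ j, z.1 j ^ a * Real.exp (-z.1 j) * (z.2 j ^ b * Real.exp (-z.2 j))) *
      ((∏ j, ∏ k ∈ Finset.Ioi j, (z.1 k - z.1 j) * (z.2 k - z.2 j)) /
        ∏ j, ∏ k, (z.1 j + z.2 k)) *
      ∏ j, ∏ k ∈ Finset.Ioi j, (z.1 k ^ θ - z.1 j ^ θ) * (z.2 k ^ θ - z.2 j ^ θ)

/-- The partition function `Z_N^B(a;θ)` of the `θ`-deformed Bures ensemble. -/
def buresPartition (a θ : ℝ) (N : ℕ) : ℝ :=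
  1 / (N.factorial : ℝ) *
    ∫ x in orthant N,
      (∏ j, ∏ k ∈ Finset.Ioi j, (x k - x j) / (x k + x j) * (x k ^ θ - x j ^ θ)) *
      ∏ j, x j ^ a * Real.exp (-x j)

/-- The Cauchy moments `I^C_{j,k}` with parameters `(a, a + 1)`, indexed from `0`. -/
def cauchyMoment (a θ : ℝ) (j k : ℕ) : ℝ :=
  ∫ z in Set.Ioi (0 : ℝ) ×ˢ Set.Ioi (0 : ℝ),
    1 / (z.1 + z.2) * z.1 ^ (j * θ + a) * z.2 ^ (k * θ + a + 1) * Real.exp (-(z.1 + z.2))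

/-- The monic `θ`-Cauchy bi-orthogonal polynomial in the first variable: the determinant of
the moments `I^C_{j,k}` (`0 ≤ j ≤ n`, `0 ≤ k ≤ n - 1`) with last column `x^j`, over `Z_n^C`. -/
def cauchyP (a θ : ℝ) (n : ℕ) : ℝ[X] :=
  C (cauchyPartition a (a + 1) θ n)⁻¹ *
    (Matrix.of fun j k : Fin (n + 1) =>
      if (k : ℕ) < n then C (cauchyMoment a θ j k) else X ^ (j : ℕ)).det

/-- The monic `θ`-Cauchy bi-orthogonal polynomial in the second variable: the determinant of
the moments `I^C_{j,k}` (`0 ≤ j ≤ n - 1`, `0 ≤ k ≤ n`) with last row `y^k`, over `Z_n^C`. -/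
def cauchyQ (a θ : ℝ) (n : ℕ) : ℝ[X] :=
  C (cauchyPartition a (a + 1) θ n)⁻¹ *
    (Matrix.of fun j k : Fin (n + 1) =>
      if (j : ℕ) < n then C (cauchyMoment a θ j k) else X ^ (k : ℕ)).det

/-- The skew-symmetric Bures inner product of two polynomials. -/
def buresInner (a θ : ℝ) (p q : ℝ[X]) : ℝ :=
  ∫ z in Set.Ioi (0 : ℝ) ×ˢ Set.Ioi (0 : ℝ),
    (z.2 - z.1) / (z.2 + z.1) * p.eval (z.1 ^ θ) * q.eval (z.2 ^ θ) *
      z.1 ^ a * z.2 ^ a * Real.exp (-(z.1 + z.2))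

/-- The single Bures moments `i^B_j`, indexed from `0`. -/
def buresMoment (a θ : ℝ) (j : ℕ) : ℝ :=
  ∫ x in Set.Ioi (0 : ℝ), x ^ (j * θ + a) * Real.exp (-x)

/-- `φ` is the family of `θ`-Bures (partial-skew-orthogonal) polynomials: `φ n` is monic of
degree `n`, and the family satisfies the partial skew-orthogonality conditions. -/
structure IsThetaBures (a θ : ℝ) (φ : ℕ → ℝ[X]) : Prop where
  monic : ∀ n, (φ n).Monic
  natDegree_eq : ∀ n, (φ n).natDegree = n
  even : ∀ n i, i ≤ 2 * n + 1 →
    buresInner a θ (φ (2 * n)) (X ^ i) =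
      if i = 2 * n + 1 then buresPartition a θ (2 * n + 2) / buresPartition a θ (2 * n) else 0
  odd : ∀ n i, i ≤ 2 * n + 1 →
    buresInner a θ (φ (2 * n + 1)) (X ^ i) =
      -(buresPartition a θ (2 * n + 2) / buresPartition a θ (2 * n + 1)) * buresMoment a θ i

end ThetaDeformed

end

/-! Since y/(x+y) = (1 + (y-x)/(y+x))/2, the extra factor y in the Cauchy weight splits the Cauchy
moments into a rank-one and a skew part: I_{jk} = (i_j i_k + J_{jk})/2, with J_{jk} the moments of
the Bures form (`cauchyMoment_eq`). Let L be the functional z^j ↦ i_j. Then P̃_n is the monic p of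
degree n with L(p) i_k + ⟨p, z^k⟩ = 0 for k < n, and Q̃_n the one with L(p) i_k - ⟨p, z^k⟩ = 0
(`cauchyP_eq`, `cauchyQ_eq`).

The polynomial φ_n is explicit: up to sign, its z^k-coefficient is the moment of Schur's product
with exponents 0, …, n except k, over Z_n^B. The partial fractions of ∏ (y - x_k)/(y + x_k) give
L(φ_n) and ⟨φ_n, z^i⟩ (`sum_schurMoment_mul_integral`, `sum_schurMoment_mul_skewMoment`). For k ≤ n:
if n is even, L(φ_n) = Z_{n+1}/Z_n and ⟨φ_n, z^k⟩ = 0; if n is odd, L(φ_n) = 0 and ⟨φ_n, z^k⟩ =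
-(Z_{n+1}/Z_n) i_k. So L(φ_n) i_k ± ⟨φ_n, z^k⟩ is always a multiple of i_k, and a combination of φ_n
and φ_{n-1} cancels it. Adding the formulas for P̃_n and Q̃_n gives 2φ_n.

Positivity of the partition functions justifies the divisions. Uniqueness of φ is nondegeneracy of
the Bures form on polynomials of degree less than 2m. -/

noncomputable section

namespace ThetaDeformed

/-! ### Schur's product and partial fractions of the skew kernel. -/

/-- The skew kernel `(y - x) / (y + x)`. -/
def skewKernel (x y : ℝ) : ℝ := (y - x) / (y + x)

/-- Schur's product `∏_{j<k} (x_k - x_j) / (x_k + x_j)`. -/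
def schurProd {N : ℕ} (x : Fin N → ℝ) : ℝ :=
  ∏ j, ∏ k ∈ Finset.Ioi j, skewKernel (x j) (x k)

theorem skewKernel_neg_swap (x y : ℝ) : skewKernel x y = -skewKernel y x := by
  unfold skewKernel
  rw [add_comm x y, ← neg_div, neg_sub]

theorem abs_skewKernel_le_one {x y : ℝ} (hx : 0 < x) (hy : 0 < y) : |skewKernel x y| ≤ 1 := by
  unfold skewKernel
  rw [abs_div, abs_of_pos (add_pos hy hx), div_le_one (add_pos hy hx), abs_le]
  constructor <;> linarith

theorem measurable_skewKernel : Measurable fun p : ℝ × ℝ => skewKernel p.1 p.2 := by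
  unfold skewKernel
  fun_prop

theorem abs_schurProd_le_one {N : ℕ} {x : Fin N → ℝ} (hx : ∀ i, 0 < x i) :
    |schurProd x| ≤ 1 := by
  unfold schurProd
  simp only [Finset.abs_prod]
  exact Finset.prod_le_one (fun _ _ => Finset.prod_nonneg fun _ _ => abs_nonneg _) fun i _ =>
    Finset.prod_le_one (fun _ _ => abs_nonneg _) fun j _ => abs_skewKernel_le_one (hx i) (hx j)

theorem measurable_schurProd {N : ℕ} : Measurable (schurProd : (Fin N → ℝ) → ℝ) := by
  unfold schurProd skewKernel
  fun_prop

theorem schurProd_comp_perm {N : ℕ} (x : Fin N → ℝ) (σ : Equiv.Perm (Fin N)) :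
    schurProd (fun j => x (σ j)) = (Equiv.Perm.sign σ : ℤ) * schurProd x := by
  unfold schurProd
  exact Equiv.Perm.prod_Ioi_comp_eq_sign_mul_prod (R := ℝ) σ
    (f := fun i j => skewKernel (x i) (x j)) fun i j => skewKernel_neg_swap _ _

theorem schurProd_succ {n : ℕ} (x : Fin (n + 1) → ℝ) :
    schurProd x = (∏ j, skewKernel (x 0) (x (Fin.succ j))) * schurProd fun j => x (Fin.succ j) := by
  unfold schurProd
  rw [Fin.prod_univ_succ, Fin.prod_Ioi_zero]
  simp only [Fin.prod_Ioi_succ]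

/-- Splitting off the `k`-th variable of Schur's product. -/
theorem schurProd_succAbove {n : ℕ} (x : Fin (n + 1) → ℝ) (k : Fin (n + 1)) :
    (-1) ^ (k : ℕ) * schurProd x =
      (∏ j, skewKernel (x k) (x (k.succAbove j))) * schurProd fun j => x (k.succAbove j) := by
  -- This cycle, of sign (-1)^k, moves x_k to the front and keeps the order of the others.
  have h := schurProd_comp_perm x k.cycleRange.symm
  rw [Equiv.Perm.sign_symm, Fin.sign_cycleRange, schurProd_succ] at h
  simp only [Fin.cycleRange_symm_zero, Fin.cycleRange_symm_succ] at h
  rw [h]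
  simp

/-- The residues of `∏ (y - x_k) / (y + x_k)`, normalised by `-2 x_k`. -/
def kernelResidue {n : ℕ} (x : Fin (n + 1) → ℝ) (k : Fin (n + 1)) : ℝ :=
  ∏ j, (x k + x (k.succAbove j)) / (x k - x (k.succAbove j))

/-- Both sides have degree at most n in y, as the leading terms on the left cancel, so it suffices
to compare them at the n + 1 points y = -x_m. There the second product vanishes, and only the term k
= m survives on the right. -/
theorem prod_sub_sub_prod_add {n : ℕ} {x : Fin (n + 1) → ℝ} (hx : Function.Injective x) (y : ℝ) :
    ∏ k, (y - x k) - ∏ k, (y + x k) =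
      ∑ k, kernelResidue x k * (-2 * x k) * ∏ j, (y + x (k.succAbove j)) := by
  set A : ℝ[X] := Lagrange.nodal Finset.univ x - Lagrange.nodal Finset.univ (fun k => -x k)
  set B : ℝ[X] := ∑ k, C (kernelResidue x k * (-2 * x k)) *
    Lagrange.nodal Finset.univ (fun j => -x (k.succAbove j))
  have key : A = B := by
    refine Polynomial.eq_of_degrees_lt_of_eval_index_eq (s := Finset.univ)
      (v := fun k => -x k) (fun i _ j _ h => hx (neg_injective h)) ?_ ?_ ?_
    · refine (degree_sub_lt_left ?_ Lagrange.nodal_ne_zero ?_).trans_eq ?_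
      · simp [Lagrange.degree_nodal]
      · rw [Lagrange.nodal_monic.leadingCoeff, Lagrange.nodal_monic.leadingCoeff]
      · simp [Lagrange.degree_nodal]
    · refine (degree_sum_le _ _).trans_lt ((Finset.sup_lt_iff ?_).2 fun k _ => ?_)
      · simp
      · rw [← smul_eq_C_mul]
        refine (degree_smul_le _ _).trans_lt ?_
        rw [Lagrange.degree_nodal]
        simp only [Finset.card_univ, Fintype.card_fin]
        exact_mod_cast Nat.lt_succ_self n
    · intro m _
      simp only [A, B, eval_sub, Lagrange.eval_nodal, eval_finsetSum, eval_mul, eval_C]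
      rw [Finset.sum_eq_single m]
      · rw [Finset.prod_eq_zero (i := m) (Finset.mem_univ _)
          (f := fun k => -x m - -x k) (by simp), sub_zero, Fin.prod_univ_succAbove _ m,
          kernelResidue, mul_right_comm, mul_comm _ (-2 * x m)]
        congr 1
        · ring
        · rw [← Finset.prod_mul_distrib]
          refine Finset.prod_congr rfl fun j _ => ?_
          have : x m - x (m.succAbove j) ≠ 0 :=
            sub_ne_zero.2 fun h => (Fin.succAbove_ne m j) (hx h).symm
          field_simp
          ring
      · intro k _ hk
        obtain ⟨j, hj⟩ := Fin.exists_succAbove_eq hk.symm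
        rw [Finset.prod_eq_zero (i := j) (Finset.mem_univ _) (by simp [hj]), mul_zero]
      · simp
  have := congrArg (eval y) key
  simpa [A, B, Lagrange.eval_nodal, eval_finsetSum] using this

/-- This is the interpolation identity at y = 0, divided by ∏ x_k. It is the source of every
dependence on the parity of n below. -/
theorem two_mul_sum_kernelResidue {n : ℕ} {x : Fin (n + 1) → ℝ} (hx : Function.Injective x)
    (h0 : ∀ i, 0 < x i) : 2 * ∑ k, kernelResidue x k = 1 + (-1) ^ n := by
  have h := prod_sub_sub_prod_add hx 0
  have hp : ∏ k, x k ≠ 0 := Finset.prod_ne_zero_iff.2 fun k _ => (h0 k).ne'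
  simp only [zero_sub, zero_add, Finset.prod_neg, Finset.card_univ, Fintype.card_fin] at h
  have h2 : ∀ k, kernelResidue x k * (-2 * x k) * ∏ j, x (k.succAbove j) =
      -(2 * kernelResidue x k) * ∏ k, x k := fun k => by
    rw [Fin.prod_univ_succAbove _ k]; ring
  rw [Finset.sum_congr rfl fun k _ => h2 k, ← Finset.sum_mul, Finset.sum_neg_distrib,
    ← Finset.mul_sum, pow_succ] at h
  apply mul_right_cancel₀ hp
  linear_combination h

theorem sum_kernelResidue {n : ℕ} {x : Fin (n + 1) → ℝ} (hx : Function.Injective x)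
    (h0 : ∀ i, 0 < x i) : ∑ k, kernelResidue x k = if Even n then 1 else 0 := by
  have h := two_mul_sum_kernelResidue hx h0
  split_ifs with hn
  · rw [hn.neg_one_pow] at h; linarith
  · rw [(Nat.not_even_iff_odd.1 hn).neg_one_pow] at h; linarith

/-- Partial fraction expansion of the product of kernels. -/
theorem sum_kernelResidue_mul_skewKernel {n : ℕ} {x : Fin (n + 1) → ℝ}
    (hx : Function.Injective x) (h0 : ∀ i, 0 < x i) {y : ℝ} (hy : 0 < y) :
    ∑ k, kernelResidue x k * skewKernel (x k) y =
      ∏ k, skewKernel (x k) y - if Even n then 0 else 1 := by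
  have h := prod_sub_sub_prod_add hx y
  have hp : ∏ k, (y + x k) ≠ 0 := Finset.prod_ne_zero_iff.2 fun k _ => (add_pos hy (h0 k)).ne'
  have h2 : ∀ k, kernelResidue x k * (-2 * x k) * ∏ j, (y + x (k.succAbove j)) =
      (kernelResidue x k * skewKernel (x k) y - kernelResidue x k) * ∏ k, (y + x k) := fun k => by
    have : y + x k ≠ 0 := (add_pos hy (h0 k)).ne'
    rw [Fin.prod_univ_succAbove (fun k => y + x k) k, skewKernel]
    field_simp
    ring
  rw [Finset.sum_congr rfl fun k _ => h2 k, ← Finset.sum_mul, Finset.sum_sub_distrib,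
    sum_kernelResidue hx h0] at h
  have h3 : ∏ k, (y - x k) = (∏ k, skewKernel (x k) y) * ∏ k, (y + x k) := by
    unfold skewKernel
    rw [Finset.prod_div_distrib, div_mul_cancel₀ _ hp]
  rw [h3] at h
  apply mul_right_cancel₀ hp
  split_ifs at h ⊢ <;> linear_combination -h

/-- Deleting x_k removes n kernels from Schur's product, and each of them times the matching factor
of `kernelResidue` is -1. Residue sums thus become alternating sums over deleted variables. -/
theorem schurProd_mul_kernelResidue {n : ℕ} {x : Fin (n + 1) → ℝ} (hx : Function.Injective x)
    (h0 : ∀ i, 0 < x i) (k : Fin (n + 1)) :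
    (-1) ^ (n + k : ℕ) * schurProd (fun j => x (k.succAbove j)) =
      schurProd x * kernelResidue x k := by
  have h := schurProd_succAbove x k
  have h1 : (∏ j, skewKernel (x k) (x (k.succAbove j))) * kernelResidue x k = (-1) ^ n := by
    rw [kernelResidue, ← Finset.prod_mul_distrib]
    rw [Finset.prod_congr rfl (g := fun _ => (-1 : ℝ))]
    · simp
    intro j _
    have h2 : x k - x (k.succAbove j) ≠ 0 :=
      sub_ne_zero.2 fun h => (Fin.succAbove_ne k j) (hx h).symm
    have h3 : x k + x (k.succAbove j) ≠ 0 := (add_pos (h0 _) (h0 _)).ne'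
    rw [skewKernel, add_comm (x (k.succAbove j))]
    field_simp
    ring
  have h4 : ((-1 : ℝ) ^ (k : ℕ)) * (-1) ^ (k : ℕ) = 1 := by
    rw [← mul_pow]; simp
  rw [pow_add, ← h1]
  calc _ = (-1) ^ (k : ℕ) * kernelResidue x k * ((∏ j, skewKernel (x k) (x (k.succAbove j))) *
        schurProd fun j => x (k.succAbove j)) := by ring
    _ = _ := by rw [← h]; linear_combination kernelResidue x k * schurProd x * h4

theorem sum_schurProd_succAbove {n : ℕ} {x : Fin (n + 1) → ℝ} (hx : Function.Injective x)
    (h0 : ∀ i, 0 < x i) :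
    ∑ k : Fin (n + 1), (-1) ^ (n + k : ℕ) * schurProd (fun j => x (k.succAbove j)) =
      if Even n then schurProd x else 0 := by
  simp only [schurProd_mul_kernelResidue hx h0, ← Finset.mul_sum, sum_kernelResidue hx h0]
  simp

theorem sum_schurProd_succAbove_mul_skewKernel {n : ℕ} {x : Fin (n + 1) → ℝ}
    (hx : Function.Injective x) (h0 : ∀ i, 0 < x i) {y : ℝ} (hy : 0 < y) :
    ∑ k : Fin (n + 1), (-1) ^ (n + k : ℕ) * schurProd (fun j => x (k.succAbove j)) *
        skewKernel (x k) y =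
      schurProd x * (∏ k, skewKernel (x k) y) - if Even n then 0 else schurProd x := by
  simp only [schurProd_mul_kernelResidue hx h0, mul_assoc, ← Finset.mul_sum,
    sum_kernelResidue_mul_skewKernel hx h0 hy]
  split_ifs <;> ring

/-- Adjoining a last variable to Schur's product. -/
theorem schurProd_last {n : ℕ} (x : Fin (n + 1) → ℝ) :
    schurProd x = schurProd (fun j => x ((Fin.last n).succAbove j)) *
      ∏ j, skewKernel (x ((Fin.last n).succAbove j)) (x (Fin.last n)) := by
  have h := schurProd_succAbove x (Fin.last n)
  simp only [skewKernel_neg_swap (x (Fin.last n)), Finset.prod_neg, Finset.card_univ,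
    Fintype.card_fin, Fin.val_last] at h
  apply mul_left_cancel₀ (pow_ne_zero n (neg_ne_zero.2 one_ne_zero) : (-1 : ℝ) ^ n ≠ 0)
  rw [h]; ring

/-! ### Cauchy's determinant. -/

/-- Cauchy's determinant. -/
theorem det_cauchy {N : ℕ} {x y : Fin N → ℝ} (h : ∀ j k, x j + y k ≠ 0) :
    (Matrix.of fun j k => 1 / (x j + y k)).det =
      (∏ j, ∏ k ∈ Finset.Ioi j, (x k - x j) * (y k - y j)) / ∏ j, ∏ k, (x j + y k) := by
  by_cases hy : Function.Injective y
  swap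
  · obtain ⟨j, k, hjk, hne⟩ : ∃ j k, y j = y k ∧ j ≠ k := by
      simpa [Function.Injective] using hy
    have h0 : ∏ j, ∏ k ∈ Finset.Ioi j, (y k - y j) = 0 := by
      rw [← Matrix.det_vandermonde]
      exact Matrix.det_vandermonde_eq_zero_iff.2 ⟨j, k, hjk, hne⟩
    rw [Matrix.det_zero_of_column_eq hne (by simp [hjk])]
    simp only [Finset.prod_mul_distrib, h0]
    simp
  -- Clearing the denominator of row j turns 1/(x_j + y_k) into q_k(x_j), so the determinant is the
  -- Vandermonde product of x times the determinant of the coefficients of the q_k.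
  set q : Fin N → ℝ[X] := fun k => ∏ l ∈ ({k}ᶜ : Finset (Fin N)), (X + C (y l))
  have hq : ∀ k, (q k).natDegree < N := fun k => by
    have hN : 0 < N := k.pos
    rw [natDegree_prod_of_monic _ _ fun l _ => monic_X_add_C _]
    simp [Finset.card_compl]
    omega
  have hV : ∀ v : Fin N → ℝ, (Matrix.of fun j k => (q k).eval (v j)).det =
      (∏ j, ∏ k ∈ Finset.Ioi j, (v k - v j)) *
        (Matrix.of fun i k : Fin N => (q k).coeff i).det := fun v => by
    rw [← Matrix.det_vandermonde, ← Matrix.det_mul]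
    congr 1
    ext j k
    rw [Matrix.mul_apply, Matrix.of_apply, eval_eq_sum_range' (hq k), Finset.sum_range]
    simp [Matrix.vandermonde_apply, mul_comm]
  have hc : (Matrix.of fun i k : Fin N => (q k).coeff i).det =
      ∏ j, ∏ k ∈ Finset.Ioi j, (y k - y j) := by
    -- The coefficient determinant does not depend on the evaluation points. At x_j = -y_j the
    -- matrix is diagonal; its determinant contains both orders of each pair, and one order cancels
    -- because the y_j are distinct.
    have h1 := hV fun j => -y j
    have h2 : (Matrix.of fun j k => (q k).eval (-y j)) =
        Matrix.diagonal fun k => ∏ l ∈ ({k}ᶜ : Finset (Fin N)), (y l - y k) := by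
      ext j k
      by_cases hjk : j = k
      · subst hjk
        simp [q, eval_prod, neg_add_eq_sub]
      · rw [Matrix.diagonal_apply_ne _ hjk]
        simp only [q, Matrix.of_apply, eval_prod]
        exact Finset.prod_eq_zero (i := j) (by simp [hjk]) (by simp)
    rw [h2, Matrix.det_diagonal,
      ← Finset.prod_prod_Ioi_mul_eq_prod_prod_off_diag (fun l k => y l - y k)] at h1
    simp only [Finset.prod_mul_distrib, neg_sub_neg] at h1
    have h3 : ∏ j, ∏ k ∈ Finset.Ioi j, (y j - y k) ≠ 0 :=
      Finset.prod_ne_zero_iff.2 fun j _ => Finset.prod_ne_zero_iff.2 fun k hk =>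
        sub_ne_zero.2 fun h => (Finset.mem_Ioi.1 hk).ne (hy h)
    apply mul_left_cancel₀ h3
    rw [← h1, mul_comm]
  have hH : (Matrix.of fun j k => 1 / (x j + y k)) =
      Matrix.diagonal (fun j => (∏ k, (x j + y k))⁻¹) *
        Matrix.of fun j k => (q k).eval (x j) := by
    ext j k
    rw [Matrix.diagonal_mul]
    simp only [Matrix.of_apply, q, eval_prod, eval_add, eval_X, eval_C]
    have h1 := Finset.prod_mul_prod_compl ({k} : Finset (Fin N)) fun k => x j + y k
    have h2 : ∏ k, (x j + y k) ≠ 0 := Finset.prod_ne_zero_iff.2 fun k _ => h j k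
    rw [Finset.prod_singleton] at h1
    have := h j k
    field_simp
    linear_combination -h1
  rw [hH, Matrix.det_mul, Matrix.det_diagonal, hV, hc, Finset.prod_inv_distrib]
  simp only [Finset.prod_mul_distrib]
  rw [div_eq_inv_mul]

/-! ### Permuting and splitting off variables in product measures. -/

theorem measurePreserving_comp_perm (μ : Measure ℝ) [SigmaFinite μ] {N : ℕ}
    (σ : Equiv.Perm (Fin N)) :
    MeasurePreserving (MeasurableEquiv.piCongrLeft (fun _ : Fin N => ℝ) σ.symm)
      (Measure.pi fun _ => μ) (Measure.pi fun _ => μ) :=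
  measurePreserving_piCongrLeft (fun _ : Fin N => μ) σ.symm

theorem piCongrLeft_symm_apply {N : ℕ} (σ : Equiv.Perm (Fin N)) (x : Fin N → ℝ) :
    MeasurableEquiv.piCongrLeft (fun _ : Fin N => ℝ) σ.symm x = fun j => x (σ j) := by
  ext j
  have := Equiv.piCongrLeft_apply_apply (fun _ : Fin N => ℝ) σ.symm x (σ j)
  simpa [MeasurableEquiv.coe_piCongrLeft] using this

theorem integral_comp_perm (μ : Measure ℝ) [SigmaFinite μ] {N : ℕ} (σ : Equiv.Perm (Fin N))
    (F : (Fin N → ℝ) → ℝ) :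
    ∫ x, F (fun j => x (σ j)) ∂(Measure.pi fun _ => μ) = ∫ x, F x ∂(Measure.pi fun _ => μ) := by
  rw [← (measurePreserving_comp_perm μ σ).integral_comp' F]
  simp only [piCongrLeft_symm_apply]

theorem integral_succAbove (μ : Measure ℝ) [SigmaFinite μ] {n : ℕ} (k : Fin (n + 1))
    (F : ℝ × (Fin n → ℝ) → ℝ) :
    ∫ x : Fin (n + 1) → ℝ, F (x k, fun j => x (k.succAbove j)) ∂(Measure.pi fun _ => μ) =
      ∫ p, F p ∂(μ.prod (Measure.pi fun _ => μ)) :=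
  (measurePreserving_piFinSuccAbove (fun _ : Fin (n + 1) => μ) k).integral_comp' F

theorem ae_pi_pos {μ : Measure ℝ} [SigmaFinite μ] (hμ : ∀ᵐ x ∂μ, 0 < x) (N : ℕ) :
    ∀ᵐ x ∂(Measure.pi fun _ : Fin N => μ), ∀ i, 0 < x i :=
  ae_all_iff.2 fun _ => Measure.tendsto_eval_ae_ae.eventually hμ

/-- The partial fraction identities need distinct points; coincidences lie on null hyperplanes
because μ has no atoms. -/
theorem ae_pi_injective (μ : Measure ℝ) [SigmaFinite μ] [NullSingletonClass μ] (N : ℕ) :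
    ∀ᵐ x ∂(Measure.pi fun _ : Fin N => μ), Function.Injective x := by
  have h : ∀ i j : Fin N, i ≠ j → ∀ᵐ x ∂(Measure.pi fun _ : Fin N => μ), x i ≠ x j := by
    intro i j hij
    cases N with
    | zero => exact i.elim0
    | succ n =>
      obtain ⟨l, rfl⟩ := Fin.exists_succAbove_eq hij.symm
      have hmp := measurePreserving_piFinSuccAbove (fun _ : Fin (n + 1) => μ) i
      have h1 : ∀ᵐ p ∂(μ.prod (Measure.pi fun _ : Fin n => μ)), p.1 ≠ p.2 l := by
        have hm : MeasurableSet {p : ℝ × (Fin n → ℝ) | p.1 ≠ p.2 l} :=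
          (measurableSet_eq_fun (by fun_prop) (by fun_prop)).compl
        refine (Measure.ae_prod_iff_ae_ae hm).2 (Filter.Eventually.of_forall fun x => ?_)
        rw [ae_iff]
        simpa [eq_comm] using Measure.pi_hyperplane (fun _ : Fin n => μ) l x
      exact hmp.quasiMeasurePreserving.ae h1
  have h' := ae_all_iff.2 fun i => ae_all_iff.2 fun j => ae_all_iff.2 (h i j)
  filter_upwards [h'] with x hx i j hij
  by_contra hne
  exact hx i j hne hij

/-! ### Moments of Schur's product. -/

/-- The moment `∫ S(x) ∏_j g_{e_j}(x_j)` of Schur's product. -/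
def schurMoment (μ : Measure ℝ) (g : ℕ → ℝ → ℝ) {N : ℕ} (e : Fin N → ℕ) : ℝ :=
  ∫ x, schurProd x * ∏ j, g (e j) (x j) ∂(Measure.pi fun _ => μ)

/-- The moment of the skew kernel against `g_j ⊗ g_k`. -/
def skewMoment (μ : Measure ℝ) (g : ℕ → ℝ → ℝ) (j k : ℕ) : ℝ :=
  ∫ p, skewKernel p.1 p.2 * (g j p.1 * g k p.2) ∂(μ.prod μ)

theorem integrable_skewKernel_mul {μ : Measure ℝ} {g : ℕ → ℝ → ℝ} (hμ : ∀ᵐ x ∂μ, 0 < x)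
    (hg : ∀ k, Integrable (g k) μ) (j k : ℕ) :
    Integrable (fun p : ℝ × ℝ => skewKernel p.1 p.2 * (g j p.1 * g k p.2)) (μ.prod μ) := by
  refine ((hg j).mul_prod (hg k)).bdd_mul (c := 1)
    measurable_skewKernel.aestronglyMeasurable ?_
  filter_upwards [Measure.quasiMeasurePreserving_fst.ae hμ,
    Measure.quasiMeasurePreserving_snd.ae hμ] with p h1 h2 using abs_skewKernel_le_one h1 h2

section

variable {μ : Measure ℝ} [SigmaFinite μ] {g : ℕ → ℝ → ℝ}

theorem integrable_schurProd_mul (hμ : ∀ᵐ x ∂μ, 0 < x) (hg : ∀ k, Integrable (g k) μ) {N : ℕ}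
    (e : Fin N → ℕ) :
    Integrable (fun x => schurProd x * ∏ j, g (e j) (x j)) (Measure.pi fun _ => μ) := by
  refine (Integrable.fintype_prod fun j => hg (e j)).bdd_mul (c := 1)
    measurable_schurProd.aestronglyMeasurable ?_
  filter_upwards [ae_pi_pos hμ N] with x hx using abs_schurProd_le_one hx

theorem schurMoment_comp_perm {N : ℕ} (e : Fin N → ℕ) (σ : Equiv.Perm (Fin N)) :
    schurMoment μ g (fun j => e (σ j)) = (Equiv.Perm.sign σ : ℤ) * schurMoment μ g e := by
  unfold schurMoment
  rw [← integral_comp_perm μ σ (fun x => schurProd x * ∏ j, g (e (σ j)) (x j)),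
    ← integral_const_mul]
  congr 1
  ext x
  rw [schurProd_comp_perm, Equiv.prod_comp σ (fun j => g (e j) (x j)), mul_assoc]

theorem schurMoment_eq_zero {N : ℕ} {e : Fin N → ℕ} {i j : Fin N} (hij : i ≠ j)
    (he : e i = e j) : schurMoment μ g e = 0 := by
  have h := schurMoment_comp_perm (μ := μ) (g := g) e (Equiv.swap i j)
  have h2 : (fun l => e (Equiv.swap i j l)) = e := by
    ext l
    rw [Equiv.swap_apply_def]
    split_ifs with h1 h2
    · rw [h1, he]
    · rw [h2, he]
    · rfl
  rw [h2, Equiv.Perm.sign_swap hij] at h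
  push_cast at h
  linarith

/-- Schur's product is antisymmetric, so all N! terms of the Leibniz expansion have the same
integral. This absorbs the factor 1/N! of the partition function. -/
theorem integral_schurProd_mul_det (hμ : ∀ᵐ x ∂μ, 0 < x) (hg : ∀ k, Integrable (g k) μ) {N : ℕ}
    (e : Fin N → ℕ) :
    ∫ x, schurProd x * (Matrix.of fun k j => g (e k) (x j)).det ∂(Measure.pi fun _ => μ) =
      N.factorial * schurMoment μ g e := by
  have h1 : ∀ x : Fin N → ℝ, schurProd x * (Matrix.of fun k j => g (e k) (x j)).det =
      ∑ σ : Equiv.Perm (Fin N), (Equiv.Perm.sign σ : ℤ) *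
        (schurProd x * ∏ j, g (e (σ j)) (x j)) := fun x => by
    rw [Matrix.det_apply', Finset.mul_sum]
    exact Finset.sum_congr rfl fun σ _ => by simp only [Matrix.of_apply]; ring
  simp only [h1]
  rw [integral_finsetSum _ fun σ _ =>
    (integrable_schurProd_mul hμ hg fun j => e (σ j)).const_mul _]
  have h2 : ∀ σ : Equiv.Perm (Fin N), ∫ x, (Equiv.Perm.sign σ : ℤ) *
      (schurProd x * ∏ j, g (e (σ j)) (x j)) ∂(Measure.pi fun _ => μ) = schurMoment μ g e := by
    intro σ
    rw [integral_const_mul]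
    change _ * schurMoment μ g (fun j => e (σ j)) = _
    rw [schurMoment_comp_perm, ← mul_assoc, ← Int.cast_mul, Int.units_coe_mul_self]
    simp
  simp only [h2]
  simp [Fintype.card_perm]

/-- The bounded factor `w` stands for the constant 1 in the single moments and for x ↦ `skewKernel x
y` in the skew moments. -/
theorem integrable_schurProd_succAbove_mul (hμ : ∀ᵐ x ∂μ, 0 < x) (hg : ∀ k, Integrable (g k) μ)
    {n : ℕ} (k : Fin (n + 1)) {w : ℝ → ℝ} (hw : Measurable w) (hw1 : ∀ x, 0 < x → |w x| ≤ 1) :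
    Integrable (fun x : Fin (n + 1) → ℝ => schurProd (fun j => x (k.succAbove j)) * w (x k) *
      ∏ j : Fin (n + 1), g j (x j)) (Measure.pi fun _ => μ) := by
  refine (Integrable.fintype_prod fun j : Fin (n + 1) => hg j).bdd_mul (c := 1) ?_ ?_
  · exact ((measurable_schurProd.comp (by fun_prop)).mul
      (hw.comp (by fun_prop))).aestronglyMeasurable
  · filter_upwards [ae_pi_pos hμ (n + 1)] with x hx
    rw [Real.norm_eq_abs, abs_mul]
    exact mul_le_one₀ (abs_schurProd_le_one fun j => hx _) (abs_nonneg _) (hw1 _ (hx k))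

theorem integral_schurProd_succAbove_mul {n : ℕ} (k : Fin (n + 1)) (w : ℝ → ℝ) :
    ∫ x : Fin (n + 1) → ℝ, schurProd (fun j => x (k.succAbove j)) * w (x k) *
      ∏ j : Fin (n + 1), g j (x j) ∂(Measure.pi fun _ => μ) =
    schurMoment μ g (fun j : Fin n => (k.succAbove j : ℕ)) * ∫ x, w x * g k x ∂μ := by
  have h := integral_succAbove μ k fun p => (w p.1 * g k p.1) *
    (schurProd p.2 * ∏ j : Fin n, g (k.succAbove j) (p.2 j))
  rw [integral_prod_mul (fun x => w x * g k x)
    (fun x : Fin n → ℝ => schurProd x * ∏ j : Fin n, g (k.succAbove j) (x j)), mul_comm] at h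
  unfold schurMoment
  rw [← h]
  congr 1
  ext x
  rw [Fin.prod_univ_succAbove _ k]
  ring

variable [NullSingletonClass μ]

/-- By Fubini each summand is one integral over n + 1 variables; under the integral sign the sum is
`sum_schurProd_succAbove`. -/
theorem sum_schurMoment_mul_integral (hμ : ∀ᵐ x ∂μ, 0 < x) (hg : ∀ k, Integrable (g k) μ)
    (n : ℕ) :
    ∑ k : Fin (n + 1), (-1) ^ (n + k : ℕ) *
      schurMoment μ g (fun j : Fin n => (k.succAbove j : ℕ)) * ∫ x, g k x ∂μ =
    if Even n then schurMoment μ g (fun j : Fin (n + 1) => (j : ℕ)) else 0 := by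
  have h1 : ∀ k : Fin (n + 1), (-1) ^ (n + k : ℕ) *
      schurMoment μ g (fun j : Fin n => (k.succAbove j : ℕ)) * ∫ x, g k x ∂μ =
      ∫ x : Fin (n + 1) → ℝ, (-1) ^ (n + k : ℕ) * (schurProd (fun j => x (k.succAbove j)) * 1 *
        ∏ j : Fin (n + 1), g j (x j)) ∂(Measure.pi fun _ => μ) := fun k => by
    rw [integral_const_mul, integral_schurProd_succAbove_mul k fun _ => 1, mul_assoc]
    simp
  simp only [h1]
  rw [← integral_finsetSum _ fun k _ => (integrable_schurProd_succAbove_mul hμ hg k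
    (w := fun _ => 1) measurable_const (by simp)).const_mul _]
  have h2 : (fun x : Fin (n + 1) → ℝ => ∑ k : Fin (n + 1), (-1) ^ (n + k : ℕ) *
      (schurProd (fun j => x (k.succAbove j)) * 1 * ∏ j : Fin (n + 1), g j (x j)))
      =ᵐ[Measure.pi fun _ => μ] fun x =>
      (if Even n then schurProd x else 0) * ∏ j : Fin (n + 1), g j (x j) := by
    filter_upwards [ae_pi_pos hμ (n + 1), ae_pi_injective μ (n + 1)] with x h0 hx
    rw [← sum_schurProd_succAbove hx h0, Finset.sum_mul]
    exact Finset.sum_congr rfl fun k _ => by ring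
  rw [integral_congr_ae h2]
  split_ifs
  · rfl
  · simp

/-- For fixed y, partial fractions turn the sum into Schur's product times ∏ (y - x_k)/(y + x_k),
which is Schur's product of n + 2 variables with y last; this puts the exponent `i` in the last
slot. For odd n the constant term of the expansion leaves the correction. -/
theorem sum_schurMoment_mul_skewMoment (hμ : ∀ᵐ x ∂μ, 0 < x) (hg : ∀ k, Integrable (g k) μ)
    (n i : ℕ) :
    ∑ k : Fin (n + 1), (-1) ^ (n + k : ℕ) *
      schurMoment μ g (fun j : Fin n => (k.succAbove j : ℕ)) * skewMoment μ g k i =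
    schurMoment μ g (fun j : Fin (n + 2) => if (j : ℕ) < n + 1 then (j : ℕ) else i) -
      if Even n then 0 else schurMoment μ g (fun j : Fin (n + 1) => (j : ℕ)) * ∫ x, g i x ∂μ := by
  set ε : ℝ := if Even n then 0 else 1 with hε
  set c : Fin (n + 1) → ℝ := fun k => (-1) ^ (n + k : ℕ) *
    schurMoment μ g (fun j : Fin n => (k.succAbove j : ℕ))
  have hJ : ∀ k : ℕ, skewMoment μ g k i =
      ∫ y, ∫ x, skewKernel x y * (g k x * g i y) ∂μ ∂μ := fun k => by
    rw [skewMoment, integral_prod_symm _ (integrable_skewKernel_mul hμ hg k i)]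
  have hJi : ∀ k : ℕ, Integrable (fun y => ∫ x, skewKernel x y * (g k x * g i y) ∂μ) μ :=
    fun k => (integrable_skewKernel_mul hμ hg k i).integral_prod_right
  have hinner : ∀ y, 0 < y → ∑ k, c k * ∫ x, skewKernel x y * (g k x * g i y) ∂μ =
      ∫ x : Fin (n + 1) → ℝ, (schurProd x * (∏ k, skewKernel (x k) y)) *
        ((∏ j : Fin (n + 1), g j (x j)) * g i y) ∂(Measure.pi fun _ => μ) -
      ε * schurMoment μ g (fun j : Fin (n + 1) => (j : ℕ)) * g i y := by
    intro y hy
    have h1 : ∀ k : Fin (n + 1), c k * ∫ x, skewKernel x y * (g k x * g i y) ∂μ =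
        g i y * ∫ x : Fin (n + 1) → ℝ, (-1) ^ (n + k : ℕ) *
          (schurProd (fun j => x (k.succAbove j)) * skewKernel (x k) y *
          ∏ j : Fin (n + 1), g j (x j)) ∂(Measure.pi fun _ => μ) := fun k => by
      rw [integral_const_mul, integral_schurProd_succAbove_mul k fun x => skewKernel x y]
      simp only [c, ← mul_assoc]
      rw [integral_mul_const]
      ring
    have hmeas : Measurable fun x => skewKernel x y :=
      measurable_skewKernel.comp (measurable_id.prodMk measurable_const)
    simp only [h1]
    rw [← Finset.mul_sum, ← integral_finsetSum _ fun k _ => (integrable_schurProd_succAbove_mul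
      hμ hg k hmeas fun x hx => abs_skewKernel_le_one hx hy).const_mul _]
    have h2 : (fun x : Fin (n + 1) → ℝ => ∑ k : Fin (n + 1), (-1) ^ (n + k : ℕ) *
        (schurProd (fun j => x (k.succAbove j)) * skewKernel (x k) y *
          ∏ j : Fin (n + 1), g j (x j))) =ᵐ[Measure.pi fun _ => μ] fun x =>
        (schurProd x * (∏ k, skewKernel (x k) y)) * (∏ j : Fin (n + 1), g j (x j)) -
          ε * (schurProd x * ∏ j : Fin (n + 1), g j (x j)) := by
      filter_upwards [ae_pi_pos hμ (n + 1), ae_pi_injective μ (n + 1)] with x h0 hx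
      have h3 := sum_schurProd_succAbove_mul_skewKernel hx h0 hy
      have h4 : schurProd x * (∏ k, skewKernel (x k) y) * (∏ j : Fin (n + 1), g j (x j)) -
          ε * (schurProd x * ∏ j : Fin (n + 1), g j (x j)) =
          (schurProd x * (∏ k, skewKernel (x k) y) - if Even n then 0 else schurProd x) *
          ∏ j : Fin (n + 1), g j (x j) := by
        rw [hε]; split_ifs <;> ring
      rw [h4, ← h3, Finset.sum_mul]
      exact Finset.sum_congr rfl fun k _ => by ring
    have hint : Integrable (fun x : Fin (n + 1) → ℝ => (schurProd x * (∏ k, skewKernel (x k) y)) *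
        (∏ j : Fin (n + 1), g j (x j))) (Measure.pi fun _ => μ) := by
      refine (Integrable.fintype_prod fun j : Fin (n + 1) => hg j).bdd_mul (c := 1) ?_ ?_
      · exact (measurable_schurProd.mul (Finset.measurable_prod _ fun k _ =>
          hmeas.comp (measurable_pi_apply k))).aestronglyMeasurable
      · filter_upwards [ae_pi_pos hμ (n + 1)] with x hx
        rw [Real.norm_eq_abs, abs_mul, Finset.abs_prod]
        exact mul_le_one₀ (abs_schurProd_le_one hx) (Finset.prod_nonneg fun _ _ => abs_nonneg _)
          (Finset.prod_le_one (fun _ _ => abs_nonneg _) fun k _ =>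
            abs_skewKernel_le_one (hx k) hy)
    rw [integral_congr_ae h2, integral_sub hint
      ((integrable_schurProd_mul hμ hg _).const_mul _), integral_const_mul]
    simp only [← mul_assoc]
    rw [integral_mul_const]
    unfold schurMoment
    ring
  -- The variable y becomes the last coordinate, as `schurProd_last` requires.
  have hbig := integral_succAbove μ (Fin.last (n + 1)) fun p =>
    (schurProd p.2 * (∏ k, skewKernel (p.2 k) p.1)) *
        ((∏ j : Fin (n + 1), g j (p.2 j)) * g i p.1)
  have hbigM : ∀ x : Fin (n + 2) → ℝ, schurProd x *
      ∏ j : Fin (n + 2), g (if (j : ℕ) < n + 1 then (j : ℕ) else i) (x j) =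
      (schurProd (fun j => x ((Fin.last (n + 1)).succAbove j)) *
        (∏ k, skewKernel (x ((Fin.last (n + 1)).succAbove k)) (x (Fin.last (n + 1))))) *
        ((∏ j : Fin (n + 1), g j (x ((Fin.last (n + 1)).succAbove j))) *
          g i (x (Fin.last (n + 1)))) := fun x => by
    rw [← schurProd_last, Fin.prod_univ_succAbove _ (Fin.last (n + 1)), mul_comm (∏ j, _)]
    have h1 : ∀ j : Fin (n + 1), (((Fin.last (n + 1)).succAbove j : Fin (n + 2)) : ℕ) = j := by
      simp
    simp only [h1, Fin.is_lt, if_true, Fin.val_last, lt_irrefl, if_false]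
  have hbigint : Integrable (fun p : ℝ × (Fin (n + 1) → ℝ) =>
      (schurProd p.2 * (∏ k, skewKernel (p.2 k) p.1)) *
        ((∏ j : Fin (n + 1), g j (p.2 j)) * g i p.1)) (μ.prod (Measure.pi fun _ => μ)) := by
    refine (measurePreserving_piFinSuccAbove (fun _ : Fin (n + 2) => μ)
      (Fin.last (n + 1))).integrable_comp_emb (MeasurableEquiv.measurableEmbedding _) |>.1 ?_
    refine (integrable_schurProd_mul hμ hg
      fun j : Fin (n + 2) => if (j : ℕ) < n + 1 then (j : ℕ) else i).congr
        (Filter.Eventually.of_forall fun x => ?_)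
    exact hbigM x
  calc ∑ k, c k * skewMoment μ g k i
      = ∑ k : Fin (n + 1), ∫ y, c k * ∫ x, skewKernel x y * (g k x * g i y) ∂μ ∂μ := by
        simp only [integral_const_mul, hJ]
    _ = ∫ y, ∑ k : Fin (n + 1), c k * ∫ x, skewKernel x y * (g k x * g i y) ∂μ ∂μ :=
        (integral_finsetSum _ fun (k : Fin (n + 1)) _ => (hJi k).const_mul (c k)).symm
    _ = ∫ y, (∫ x : Fin (n + 1) → ℝ, (schurProd x * (∏ k, skewKernel (x k) y)) *
        ((∏ j : Fin (n + 1), g j (x j)) * g i y) ∂(Measure.pi fun _ => μ) -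
      ε * schurMoment μ g (fun j : Fin (n + 1) => (j : ℕ)) * g i y) ∂μ := by
        refine integral_congr_ae ?_
        filter_upwards [hμ] with y hy using hinner y hy
    _ = _ := by
        rw [integral_sub hbigint.integral_prod_left ((hg i).const_mul _), integral_const_mul,
          ← integral_prod _ hbigint, ← hbig]
        congr 1
        · unfold schurMoment
          simp only [hbigM]
        · rw [hε]; split_ifs <;> simp

end

/-! ### A two-sided Andréief identity. -/

section Andreief

variable {μ : Measure ℝ} [SigmaFinite μ] {g : ℕ → ℝ → ℝ} {H : ℝ × ℝ → ℝ} {N : ℕ}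

theorem integral_prod_pi_prod (F : Fin N → ℝ × ℝ → ℝ) :
    ∫ z : (Fin N → ℝ) × (Fin N → ℝ), ∏ j, F j (z.1 j, z.2 j)
      ∂((Measure.pi fun _ => μ).prod (Measure.pi fun _ => μ)) = ∏ j, ∫ p, F j p ∂(μ.prod μ) := by
  rw [← integral_fintype_prod_eq_prod (μ := fun _ : Fin N => μ.prod μ) F,
    ← (measurePreserving_arrowProdEquivProdArrow ℝ ℝ (Fin N) (fun _ => μ)
      fun _ => μ).integral_comp']
  rfl

theorem integrable_prod_pi_prod {F : Fin N → ℝ × ℝ → ℝ} (hF : ∀ j, Integrable (F j) (μ.prod μ)) :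
    Integrable (fun z : (Fin N → ℝ) × (Fin N → ℝ) => ∏ j, F j (z.1 j, z.2 j))
      ((Measure.pi fun _ => μ).prod (Measure.pi fun _ => μ)) := by
  rw [← (measurePreserving_arrowProdEquivProdArrow ℝ ℝ (Fin N) (fun _ => μ)
      fun _ => μ).integrable_comp_emb (MeasurableEquiv.measurableEmbedding _)]
  exact Integrable.fintype_prod hF

theorem prod_mul_det_mul_det (z : (Fin N → ℝ) × (Fin N → ℝ)) :
    (∏ j, H (z.1 j, z.2 j)) * ((Matrix.of fun k j : Fin N => g k (z.1 j)).det *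
      (Matrix.of fun k j : Fin N => g k (z.2 j)).det) =
    ∑ ρ : Equiv.Perm (Fin N), ∑ τ : Equiv.Perm (Fin N),
      ((Equiv.Perm.sign ρ : ℤ) * ((Equiv.Perm.sign τ : ℤ) : ℝ)) *
        ∏ j, (H (z.1 j, z.2 j) * (g (τ j) (z.1 j) * g (ρ j) (z.2 j))) := by
  rw [Matrix.det_apply', Matrix.det_apply', mul_comm (∑ σ, _), Finset.sum_mul_sum,
    Finset.mul_sum]
  refine Finset.sum_congr rfl fun ρ _ => ?_
  rw [Finset.mul_sum]
  refine Finset.sum_congr rfl fun τ _ => ?_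
  simp only [Matrix.of_apply, Finset.prod_mul_distrib]
  ring

/-- The sign of each σ in the kernel determinant is absorbed by permuting the first set of variables
in the determinant of the `g`. Every term is then a relabelling of the one with σ = 1. -/
theorem det_mul_det_mul_det (z : (Fin N → ℝ) × (Fin N → ℝ)) :
    (Matrix.of fun j k : Fin N => H (z.1 j, z.2 k)).det *
      ((Matrix.of fun k j : Fin N => g k (z.1 j)).det *
        (Matrix.of fun k j : Fin N => g k (z.2 j)).det) =
    ∑ σ : Equiv.Perm (Fin N), (∏ j, H (z.1 (σ j), z.2 j)) *
      ((Matrix.of fun k j : Fin N => g k (z.1 (σ j))).det *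
        (Matrix.of fun k j : Fin N => g k (z.2 j)).det) := by
  rw [Matrix.det_apply' (Matrix.of fun j k : Fin N => H (z.1 j, z.2 k)), Finset.sum_mul]
  refine Finset.sum_congr rfl fun σ _ => ?_
  have h : (Matrix.of fun k j : Fin N => g k (z.1 (σ j))).det =
      (Equiv.Perm.sign σ : ℤ) * (Matrix.of fun k j : Fin N => g k (z.1 j)).det :=
    Matrix.det_permute' σ (Matrix.of fun k j : Fin N => g k (z.1 j))
  rw [h]
  simp only [Matrix.of_apply]
  ring

theorem integrable_prod_mul_det_mul_det
    (hH : ∀ j k, Integrable (fun p : ℝ × ℝ => H p * (g j p.1 * g k p.2)) (μ.prod μ)) :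
    Integrable (fun z : (Fin N → ℝ) × (Fin N → ℝ) => (∏ j, H (z.1 j, z.2 j)) *
      ((Matrix.of fun k j : Fin N => g k (z.1 j)).det *
        (Matrix.of fun k j : Fin N => g k (z.2 j)).det))
      ((Measure.pi fun _ => μ).prod (Measure.pi fun _ => μ)) := by
  simp only [prod_mul_det_mul_det]
  exact integrable_finsetSum _ fun ρ _ => integrable_finsetSum _ fun τ _ =>
    (integrable_prod_pi_prod (F := fun j p => H p * (g (τ j) p.1 * g (ρ j) p.2))
      fun j => hH _ _).const_mul _

theorem integral_prod_mul_det_mul_det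
    (hH : ∀ j k, Integrable (fun p : ℝ × ℝ => H p * (g j p.1 * g k p.2)) (μ.prod μ)) :
    ∫ z : (Fin N → ℝ) × (Fin N → ℝ), (∏ j, H (z.1 j, z.2 j)) *
      ((Matrix.of fun k j : Fin N => g k (z.1 j)).det *
        (Matrix.of fun k j : Fin N => g k (z.2 j)).det)
      ∂((Measure.pi fun _ => μ).prod (Measure.pi fun _ => μ)) =
    N.factorial * (Matrix.of fun j k : Fin N =>
      ∫ p, H p * (g j p.1 * g k p.2) ∂(μ.prod μ)).det := by
  set I : Matrix (Fin N) (Fin N) ℝ :=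
    Matrix.of fun j k : Fin N => ∫ p, H p * (g j p.1 * g k p.2) ∂(μ.prod μ)
  have hint : ∀ ρ τ : Equiv.Perm (Fin N),
      Integrable (fun z : (Fin N → ℝ) × (Fin N → ℝ) =>
        ((Equiv.Perm.sign ρ : ℤ) * ((Equiv.Perm.sign τ : ℤ) : ℝ)) *
        ∏ j, (H (z.1 j, z.2 j) * (g (τ j) (z.1 j) * g (ρ j) (z.2 j))))
      ((Measure.pi fun _ => μ).prod (Measure.pi fun _ => μ)) := fun ρ τ =>
    (integrable_prod_pi_prod (F := fun j p => H p * (g (τ j) p.1 * g (ρ j) p.2))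
      fun j => hH _ _).const_mul _
  simp only [prod_mul_det_mul_det]
  rw [integral_finsetSum _ fun ρ _ => integrable_finsetSum _ fun τ _ => hint ρ τ]
  have h1 : ∀ ρ : Equiv.Perm (Fin N), ∫ z : (Fin N → ℝ) × (Fin N → ℝ),
      ∑ τ : Equiv.Perm (Fin N), ((Equiv.Perm.sign ρ : ℤ) * ((Equiv.Perm.sign τ : ℤ) : ℝ)) *
        ∏ j, (H (z.1 j, z.2 j) * (g (τ j) (z.1 j) * g (ρ j) (z.2 j)))
      ∂((Measure.pi fun _ => μ).prod (Measure.pi fun _ => μ)) = I.det := fun ρ => by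
    rw [integral_finsetSum _ fun τ _ => hint ρ τ]
    -- For fixed ρ, the sum over τ is the determinant of `I` with columns permuted by ρ.
    have h2 : ((Equiv.Perm.sign ρ : ℤ) : ℝ) * (I.submatrix id ρ).det = I.det := by
      rw [Matrix.det_permute', ← mul_assoc, ← Int.cast_mul, Int.units_coe_mul_self]
      simp
    rw [← h2, Matrix.det_apply', Finset.mul_sum]
    refine Finset.sum_congr rfl fun τ _ => ?_
    rw [integral_const_mul,
      integral_prod_pi_prod (fun j p => H p * (g (τ j) p.1 * g (ρ j) p.2)), mul_assoc]
    rfl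
  simp only [h1]
  simp [Fintype.card_perm]

theorem integrable_comp_perm_left
    (hH : ∀ j k, Integrable (fun p : ℝ × ℝ => H p * (g j p.1 * g k p.2)) (μ.prod μ)) (σ : Equiv.Perm (Fin N)) :
    Integrable (fun z : (Fin N → ℝ) × (Fin N → ℝ) => (∏ j, H (z.1 (σ j), z.2 j)) *
      ((Matrix.of fun k j : Fin N => g k (z.1 (σ j))).det *
        (Matrix.of fun k j : Fin N => g k (z.2 j)).det))
      ((Measure.pi fun _ => μ).prod (Measure.pi fun _ => μ)) := by
  have h := ((measurePreserving_comp_perm μ σ).prod (MeasurePreserving.id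
    (Measure.pi fun _ : Fin N => μ))).integrable_comp
      (integrable_prod_mul_det_mul_det hH (N := N)).aestronglyMeasurable |>.2
      (integrable_prod_mul_det_mul_det hH)
  simpa only [Function.comp_def, Prod.map_fst, Prod.map_snd, piCongrLeft_symm_apply, id] using h

theorem integral_comp_perm_left (σ : Equiv.Perm (Fin N)) :
    ∫ z : (Fin N → ℝ) × (Fin N → ℝ), (∏ j, H (z.1 (σ j), z.2 j)) *
      ((Matrix.of fun k j : Fin N => g k (z.1 (σ j))).det *
        (Matrix.of fun k j : Fin N => g k (z.2 j)).det)
      ∂((Measure.pi fun _ => μ).prod (Measure.pi fun _ => μ)) =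
    ∫ z : (Fin N → ℝ) × (Fin N → ℝ), (∏ j, H (z.1 j, z.2 j)) *
      ((Matrix.of fun k j : Fin N => g k (z.1 j)).det *
        (Matrix.of fun k j : Fin N => g k (z.2 j)).det)
      ∂((Measure.pi fun _ => μ).prod (Measure.pi fun _ => μ)) := by
  have hmp := (measurePreserving_comp_perm μ σ).prod (MeasurePreserving.id
    (Measure.pi fun _ : Fin N => μ))
  have h := hmp.integral_comp
    ((MeasurableEquiv.piCongrLeft (fun _ : Fin N => ℝ) σ.symm).prodCongr
      (MeasurableEquiv.refl _)).measurableEmbedding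
    fun z : (Fin N → ℝ) × (Fin N → ℝ) => (∏ j, H (z.1 j, z.2 j)) *
      ((Matrix.of fun k j : Fin N => g k (z.1 j)).det *
        (Matrix.of fun k j : Fin N => g k (z.2 j)).det)
  simpa only [Prod.map_fst, Prod.map_snd, piCongrLeft_symm_apply, id] using h

theorem integrable_det_mul_det_mul_det
    (hH : ∀ j k, Integrable (fun p : ℝ × ℝ => H p * (g j p.1 * g k p.2)) (μ.prod μ)) :
    Integrable (fun z : (Fin N → ℝ) × (Fin N → ℝ) =>
      (Matrix.of fun j k : Fin N => H (z.1 j, z.2 k)).det *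
      ((Matrix.of fun k j : Fin N => g k (z.1 j)).det *
        (Matrix.of fun k j : Fin N => g k (z.2 j)).det))
      ((Measure.pi fun _ => μ).prod (Measure.pi fun _ => μ)) := by
  simp only [det_mul_det_mul_det]
  exact integrable_finsetSum _ fun σ _ => integrable_comp_perm_left hH σ

/-- A two-sided Andréief identity. -/
theorem integral_det_mul_det_mul_det
    (hH : ∀ j k, Integrable (fun p : ℝ × ℝ => H p * (g j p.1 * g k p.2)) (μ.prod μ)) :
    ∫ z : (Fin N → ℝ) × (Fin N → ℝ), (Matrix.of fun j k : Fin N => H (z.1 j, z.2 k)).det *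
      ((Matrix.of fun k j : Fin N => g k (z.1 j)).det *
        (Matrix.of fun k j : Fin N => g k (z.2 j)).det)
      ∂((Measure.pi fun _ => μ).prod (Measure.pi fun _ => μ)) =
    (N.factorial : ℝ) ^ 2 * (Matrix.of fun j k : Fin N =>
      ∫ p, H p * (g j p.1 * g k p.2) ∂(μ.prod μ)).det := by
  simp only [det_mul_det_mul_det]
  rw [integral_finsetSum _ fun σ _ => integrable_comp_perm_left hH σ]
  -- One N! counts the σ, the other comes from `integral_prod_mul_det_mul_det`.
  simp only [integral_comp_perm_left, integral_prod_mul_det_mul_det hH]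
  simp [Fintype.card_perm]
  ring

end Andreief

/-! ### The Laguerre weight on the half-line. -/

/-- Lebesgue measure on the positive half-line. -/
abbrev halfLine : Measure ℝ := volume.restrict (Set.Ioi 0)

/-- The weighted monomial `x^(kθ + a) e^{-x}`. -/
def weightedMonomial (a θ : ℝ) (k : ℕ) (x : ℝ) : ℝ := x ^ (k * θ + a) * Real.exp (-x)

theorem ae_halfLine_pos : ∀ᵐ x ∂halfLine, 0 < x := ae_restrict_mem measurableSet_Ioi

theorem weightedMonomial_eq {a θ x : ℝ} (hx : 0 < x) (k : ℕ) :
    weightedMonomial a θ k x = (x ^ θ) ^ k * (x ^ a * Real.exp (-x)) := by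
  rw [weightedMonomial, Real.rpow_add hx, mul_comm (k : ℝ) θ, Real.rpow_mul_natCast hx.le, mul_assoc]

theorem integrable_weightedMonomial {a θ : ℝ} (ha : -1 < a) (hθ : 0 < θ) (k : ℕ) :
    Integrable (weightedMonomial a θ k) halfLine := by
  have h : 0 < k * θ + a + 1 := by
    have : 0 ≤ k * θ := by positivity
    linarith
  refine (Real.GammaIntegral_convergent h).congr (Filter.Eventually.of_forall fun x => ?_)
  simp [weightedMonomial, mul_comm]

theorem orthant_eq_pi (N : ℕ) : orthant N = Set.univ.pi fun _ => Set.Ioi 0 := by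
  ext x; simp [orthant]

theorem restrict_orthant (N : ℕ) :
    (volume : Measure (Fin N → ℝ)).restrict (orthant N) = Measure.pi fun _ => halfLine := by
  rw [orthant_eq_pi, volume_pi, Measure.restrict_pi_pi]

theorem measurableSet_orthant (N : ℕ) : MeasurableSet (orthant N) := by
  rw [orthant_eq_pi]
  exact MeasurableSet.univ_pi fun _ => measurableSet_Ioi

theorem restrict_Ioi_prod :
    (volume : Measure (ℝ × ℝ)).restrict (Set.Ioi 0 ×ˢ Set.Ioi 0) = halfLine.prod halfLine := by
  rw [Measure.volume_eq_prod, Measure.prod_restrict]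

theorem restrict_orthant_prod (N : ℕ) :
    (volume : Measure ((Fin N → ℝ) × (Fin N → ℝ))).restrict (orthant N ×ˢ orthant N) =
      (Measure.pi fun _ => halfLine).prod (Measure.pi fun _ => halfLine) := by
  rw [Measure.volume_eq_prod, ← Measure.prod_restrict, restrict_orthant]

theorem ae_halfLine_prod_pos : ∀ᵐ p ∂halfLine.prod halfLine, 0 < p.1 ∧ 0 < p.2 := by
  filter_upwards [Measure.quasiMeasurePreserving_fst.ae ae_halfLine_pos,
    Measure.quasiMeasurePreserving_snd.ae ae_halfLine_pos] with p h1 h2 using ⟨h1, h2⟩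

theorem det_weightedMonomial {a θ : ℝ} {N : ℕ} {x : Fin N → ℝ} (hx : ∀ i, 0 < x i) :
    (Matrix.of fun k j : Fin N => weightedMonomial a θ k (x j)).det =
      (∏ j, ∏ k ∈ Finset.Ioi j, (x k ^ θ - x j ^ θ)) * ∏ j, x j ^ a * Real.exp (-x j) := by
  have h : (Matrix.of fun k j : Fin N => weightedMonomial a θ k (x j)) =
      (Matrix.vandermonde fun j => x j ^ θ).transpose *
        Matrix.diagonal fun j => x j ^ a * Real.exp (-x j) := by
    ext k j
    rw [Matrix.mul_diagonal, Matrix.of_apply, weightedMonomial_eq (hx j)]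
    rfl
  rw [h, Matrix.det_mul, Matrix.det_transpose, Matrix.det_vandermonde, Matrix.det_diagonal]

/-- The moments of the skew kernel for the Laguerre weight. -/
abbrev buresSkewMoment (a θ : ℝ) (j k : ℕ) : ℝ :=
  skewMoment halfLine (weightedMonomial a θ) j k

/-- The configurations of pairwise distinct points of the positive half-line. -/
def distinctOrthant (N : ℕ) : Set (Fin N → ℝ) := {x | (∀ i, 0 < x i) ∧ Function.Injective x}

/-- The set is open and contains (1, 2, …, N). Neither partition integrand vanishes at distinct
points, so this gives strict positivity. -/
theorem volume_distinctOrthant_pos (N : ℕ) : 0 < volume (distinctOrthant N) := by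
  have h : distinctOrthant N = (⋂ i, {x | 0 < x i}) ∩ ⋂ i, ⋂ j, ⋂ _ : i ≠ j, {x | x i ≠ x j} := by
    ext x
    simp only [distinctOrthant, Set.mem_ofPred_eq, Set.mem_inter_iff, Set.mem_iInter]
    refine and_congr_right fun _ => ⟨fun h i j hij => h.ne hij, fun h i j hij => ?_⟩
    by_contra hne
    exact h i j hne hij
  have ho : IsOpen (distinctOrthant N) := by
    rw [h]
    refine (isOpen_iInter_of_finite fun i => isOpen_lt continuous_const
      (continuous_apply i)).inter (isOpen_iInter_of_finite fun i => isOpen_iInter_of_finite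
      fun j => isOpen_iInter_of_finite fun _ =>
        isOpen_ne_fun (continuous_apply i) (continuous_apply j))
  refine ho.measure_pos volume ⟨fun i => (i : ℝ) + 1, fun i => by positivity, fun i j hij => ?_⟩
  simpa [Fin.ext_iff] using hij

theorem sub_mul_rpow_sub_nonneg {θ x y : ℝ} (hθ : 0 < θ) (hx : 0 < x) (hy : 0 < y) :
    0 ≤ (y - x) * (y ^ θ - x ^ θ) := by
  rcases le_total x y with h | h
  · exact mul_nonneg (sub_nonneg.2 h) (sub_nonneg.2 (Real.rpow_le_rpow hx.le h hθ.le))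
  · exact mul_nonneg_of_nonpos_of_nonpos (sub_nonpos.2 h)
      (sub_nonpos.2 (Real.rpow_le_rpow hy.le h hθ.le))

theorem rpow_sub_rpow_ne_zero {θ x y : ℝ} (hθ : 0 < θ) (hx : 0 < x) (hy : 0 < y) (h : y ≠ x) :
    y ^ θ - x ^ θ ≠ 0 :=
  sub_ne_zero.2 fun he => h ((Real.rpow_left_inj hy.le hx.le hθ.ne').1 he)

/-! ### The Bures partition function and skew form. -/

section Bures

variable {a θ : ℝ}

theorem bures_integrand_eq {N : ℕ} {x : Fin N → ℝ} (hx : ∀ i, 0 < x i) :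
    (∏ j, ∏ k ∈ Finset.Ioi j, (x k - x j) / (x k + x j) * (x k ^ θ - x j ^ θ)) *
      ∏ j, x j ^ a * Real.exp (-x j) =
    schurProd x * (Matrix.of fun k j : Fin N => weightedMonomial a θ k (x j)).det := by
  rw [det_weightedMonomial hx]
  simp only [Finset.prod_mul_distrib, schurProd, skewKernel]
  ring

theorem integrable_schurProd_mul_det (ha : -1 < a) (hθ : 0 < θ) (N : ℕ) :
    Integrable (fun x => schurProd x *
      (Matrix.of fun k j : Fin N => weightedMonomial a θ k (x j)).det)
      (Measure.pi fun _ => halfLine) := by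
  simp only [Matrix.det_apply', Finset.mul_sum, Matrix.of_apply]
  refine integrable_finsetSum _ fun σ _ => ?_
  refine ((integrable_schurProd_mul ae_halfLine_pos (integrable_weightedMonomial ha hθ)
    fun j => (σ j : ℕ)).const_mul (Equiv.Perm.sign σ : ℤ)).congr
      (Filter.Eventually.of_forall fun x => ?_)
  ring

theorem buresPartition_eq_schurMoment (ha : -1 < a) (hθ : 0 < θ) (N : ℕ) :
    buresPartition a θ N =
      schurMoment halfLine (weightedMonomial a θ) fun j : Fin N => (j : ℕ) := by
  unfold buresPartition
  rw [setIntegral_congr_fun (measurableSet_orthant N) fun x hx => bures_integrand_eq hx,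
    restrict_orthant, integral_schurProd_mul_det ae_halfLine_pos
      (integrable_weightedMonomial ha hθ) fun k : Fin N => (k : ℕ)]
  have : (N.factorial : ℝ) ≠ 0 := by positivity
  field_simp

/-- As x ↦ x^θ is increasing, x_k - x_j and x_k^θ - x_j^θ have the same sign, so the integrand is
nonnegative. -/
theorem buresPartition_pos (ha : -1 < a) (hθ : 0 < θ) (N : ℕ) : 0 < buresPartition a θ N := by
  unfold buresPartition
  refine mul_pos (by positivity) ?_
  rw [setIntegral_pos_iff_support_of_nonneg_ae]
  · refine (volume_distinctOrthant_pos N).trans_le (measure_mono fun x hx => ⟨?_, hx.1⟩)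
    refine mul_ne_zero (Finset.prod_ne_zero_iff.2 fun j _ => Finset.prod_ne_zero_iff.2
      fun k hk => ?_) (Finset.prod_ne_zero_iff.2 fun j _ => ?_)
    · have hne : x k ≠ x j := hx.2.ne (Finset.mem_Ioi.1 hk).ne'
      exact mul_ne_zero (div_ne_zero (sub_ne_zero.2 hne) (add_pos (hx.1 k) (hx.1 j)).ne')
        (rpow_sub_rpow_ne_zero hθ (hx.1 j) (hx.1 k) hne)
    · exact mul_ne_zero (Real.rpow_pos_of_pos (hx.1 j) _).ne' (Real.exp_pos _).ne'
  · refine (ae_restrict_mem (measurableSet_orthant N)).mono fun x hx => ?_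
    refine mul_nonneg (Finset.prod_nonneg fun j _ => Finset.prod_nonneg fun k _ => ?_)
      (Finset.prod_nonneg fun j _ => ?_)
    · rw [div_mul_eq_mul_div]
      exact div_nonneg (sub_mul_rpow_sub_nonneg hθ (hx j) (hx k)) (add_pos (hx k) (hx j)).le
    · exact mul_nonneg (Real.rpow_nonneg (hx j).le _) (Real.exp_pos _).le
  · refine IntegrableOn.congr_fun ?_ (fun x hx => (bures_integrand_eq hx).symm)
      (measurableSet_orthant N)
    rw [IntegrableOn, restrict_orthant]
    exact integrable_schurProd_mul_det ha hθ N

/-- The functional on polynomials with moments `m`. -/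
def momentFunctional (m : ℕ → ℝ) : ℝ[X] →ₗ[ℝ] ℝ :=
  Polynomial.lsum fun k => m k • LinearMap.id

theorem momentFunctional_eq_sum (m : ℕ → ℝ) {p : ℝ[X]} {n : ℕ} (hp : p.natDegree < n) :
    momentFunctional m p = ∑ k ∈ Finset.range n, p.coeff k * m k := by
  rw [momentFunctional, Polynomial.lsum_apply, Polynomial.sum_over_range' p _ n hp]
  · simp [mul_comm]
  · simp

theorem buresInner_X_pow (ha : -1 < a) (hθ : 0 < θ) (p : ℝ[X]) (i : ℕ) :
    buresInner a θ p (X ^ i) = momentFunctional (fun k => buresSkewMoment a θ k i) p := by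
  rw [momentFunctional_eq_sum _ p.natDegree.lt_succ_self, buresInner, restrict_Ioi_prod]
  simp only [buresSkewMoment, skewMoment, ← integral_const_mul]
  rw [← integral_finsetSum _ fun k _ => (integrable_skewKernel_mul ae_halfLine_pos
    (integrable_weightedMonomial ha hθ) k i).const_mul _]
  refine integral_congr_ae ?_
  filter_upwards [ae_halfLine_prod_pos] with z hz
  rw [eval_eq_sum_range, Finset.mul_sum, Finset.sum_mul, Finset.sum_mul, Finset.sum_mul,
    Finset.sum_mul]
  refine Finset.sum_congr rfl fun k _ => ?_
  rw [weightedMonomial_eq hz.1, weightedMonomial_eq hz.2, skewKernel, neg_add, Real.exp_add,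
    eval_pow, eval_X]
  ring

theorem buresSkewMoment_neg_swap (j k : ℕ) :
    buresSkewMoment a θ j k = -buresSkewMoment a θ k j := by
  simp only [buresSkewMoment, skewMoment]
  rw [← integral_prod_swap, ← integral_neg]
  congr 1
  ext p
  rw [Prod.fst_swap, Prod.snd_swap, skewKernel_neg_swap]
  ring

end Bures

/-! ### The Cauchy moments and partition function. -/

section Cauchy

variable {a θ : ℝ}

/-- The kernel `y / (x + y)`. -/
def cauchyKernel (p : ℝ × ℝ) : ℝ := p.2 / (p.1 + p.2)

/-- This is the bridge between the two models: with the extra factor y moved from the weight y^(a+1)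
into the kernel, both variables carry the weight of the Bures ensemble. -/
theorem cauchyKernel_eq {p : ℝ × ℝ} (h : 0 < p.1 ∧ 0 < p.2) :
    cauchyKernel p = (1 + skewKernel p.1 p.2) / 2 := by
  have : p.1 + p.2 ≠ 0 := (add_pos h.1 h.2).ne'
  have : p.2 + p.1 ≠ 0 := (add_pos h.2 h.1).ne'
  rw [cauchyKernel, skewKernel]
  field_simp
  ring

theorem cauchyKernel_mul_ae_eq (j k : ℕ) :
    (fun p : ℝ × ℝ => cauchyKernel p *
      (weightedMonomial a θ j p.1 * weightedMonomial a θ k p.2)) =ᵐ[halfLine.prod halfLine]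
    fun p => (weightedMonomial a θ j p.1 * weightedMonomial a θ k p.2 +
      skewKernel p.1 p.2 * (weightedMonomial a θ j p.1 * weightedMonomial a θ k p.2)) / 2 := by
  filter_upwards [ae_halfLine_prod_pos] with p hp
  rw [cauchyKernel_eq hp]
  ring

theorem integrable_cauchyKernel_mul (ha : -1 < a) (hθ : 0 < θ) (j k : ℕ) :
    Integrable (fun p : ℝ × ℝ => cauchyKernel p *
      (weightedMonomial a θ j p.1 * weightedMonomial a θ k p.2)) (halfLine.prod halfLine) := by
  have hg := integrable_weightedMonomial ha hθ
  exact ((((hg j).mul_prod (hg k)).add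
    (integrable_skewKernel_mul ae_halfLine_pos hg j k)).div_const 2).congr
      (cauchyKernel_mul_ae_eq j k).symm

theorem cauchyMoment_eq_integral (j k : ℕ) :
    cauchyMoment a θ j k = ∫ p, cauchyKernel p *
      (weightedMonomial a θ j p.1 * weightedMonomial a θ k p.2) ∂(halfLine.prod halfLine) := by
  rw [cauchyMoment, restrict_Ioi_prod]
  refine integral_congr_ae ?_
  filter_upwards [ae_halfLine_prod_pos] with p hp
  rw [cauchyKernel, weightedMonomial, weightedMonomial, Real.rpow_add_one hp.2.ne', neg_add,
    Real.exp_add]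
  ring

theorem cauchyMoment_eq (ha : -1 < a) (hθ : 0 < θ) (j k : ℕ) :
    cauchyMoment a θ j k =
      (buresMoment a θ j * buresMoment a θ k + buresSkewMoment a θ j k) / 2 := by
  have hg := integrable_weightedMonomial ha hθ
  rw [cauchyMoment_eq_integral, integral_congr_ae (cauchyKernel_mul_ae_eq j k), integral_div,
    integral_add ((hg j).mul_prod (hg k)) (integrable_skewKernel_mul ae_halfLine_pos hg j k),
    integral_prod_mul]
  rfl

theorem cauchy_integrand_eq {N : ℕ} {z : (Fin N → ℝ) × (Fin N → ℝ)}
    (h1 : ∀ i, 0 < z.1 i) (h2 : ∀ i, 0 < z.2 i) :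
    (∏ j, z.1 j ^ a * Real.exp (-z.1 j) * (z.2 j ^ (a + 1) * Real.exp (-z.2 j))) *
      ((∏ j, ∏ k ∈ Finset.Ioi j, (z.1 k - z.1 j) * (z.2 k - z.2 j)) /
        ∏ j, ∏ k, (z.1 j + z.2 k)) *
      ∏ j, ∏ k ∈ Finset.Ioi j, (z.1 k ^ θ - z.1 j ^ θ) * (z.2 k ^ θ - z.2 j ^ θ) =
    (Matrix.of fun j k : Fin N => cauchyKernel (z.1 j, z.2 k)).det *
      ((Matrix.of fun k j : Fin N => weightedMonomial a θ k (z.1 j)).det *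
        (Matrix.of fun k j : Fin N => weightedMonomial a θ k (z.2 j)).det) := by
  have hK : (Matrix.of fun j k : Fin N => cauchyKernel (z.1 j, z.2 k)) =
      (Matrix.of fun j k => 1 / (z.1 j + z.2 k)) * Matrix.diagonal z.2 := by
    ext j k
    rw [Matrix.mul_diagonal, Matrix.of_apply, Matrix.of_apply, cauchyKernel, div_mul_eq_mul_div,
      one_mul]
  rw [hK, Matrix.det_mul, Matrix.det_diagonal, det_cauchy fun j k => (add_pos (h1 j) (h2 k)).ne',
    det_weightedMonomial h1, det_weightedMonomial h2]
  simp only [fun j => Real.rpow_add_one (h2 j).ne' a, Finset.prod_mul_distrib]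
  ring

theorem measurableSet_orthant_prod (N : ℕ) : MeasurableSet (orthant N ×ˢ orthant N) :=
  (measurableSet_orthant N).prod (measurableSet_orthant N)

theorem cauchyPartition_eq_det (ha : -1 < a) (hθ : 0 < θ) (N : ℕ) :
    cauchyPartition a (a + 1) θ N =
      (Matrix.of fun j k : Fin N => cauchyMoment a θ j k).det := by
  unfold cauchyPartition
  rw [setIntegral_congr_fun (measurableSet_orthant_prod N)
    fun z hz => cauchy_integrand_eq hz.1 hz.2, restrict_orthant_prod,
    integral_det_mul_det_mul_det (integrable_cauchyKernel_mul ha hθ)]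
  simp only [← cauchyMoment_eq_integral]
  have : (N.factorial : ℝ) ≠ 0 := by positivity
  field_simp

theorem cauchyPartition_pos (ha : -1 < a) (hθ : 0 < θ) (N : ℕ) :
    0 < cauchyPartition a (a + 1) θ N := by
  unfold cauchyPartition
  refine mul_pos (by positivity) ?_
  rw [setIntegral_pos_iff_support_of_nonneg_ae]
  · have hpos : 0 < volume (distinctOrthant N ×ˢ distinctOrthant N) := by
      rw [Measure.volume_eq_prod, Measure.prod_prod]
      exact ENNReal.mul_pos (volume_distinctOrthant_pos N).ne' (volume_distinctOrthant_pos N).ne'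
    refine hpos.trans_le (measure_mono fun z hz => ⟨?_, hz.1.1, hz.2.1⟩)
    have h1 := hz.1.1
    have h2 := hz.2.1
    refine mul_ne_zero (mul_ne_zero (Finset.prod_ne_zero_iff.2 fun j _ => ?_) (div_ne_zero
      (Finset.prod_ne_zero_iff.2 fun j _ => Finset.prod_ne_zero_iff.2 fun k hk => ?_)
      (Finset.prod_ne_zero_iff.2 fun j _ => Finset.prod_ne_zero_iff.2 fun k _ =>
        (add_pos (h1 j) (h2 k)).ne')))
      (Finset.prod_ne_zero_iff.2 fun j _ => Finset.prod_ne_zero_iff.2 fun k hk => ?_)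
    · have := Real.rpow_pos_of_pos (h1 j) a
      have := Real.rpow_pos_of_pos (h2 j) (a + 1)
      positivity
    · have hne := (Finset.mem_Ioi.1 hk).ne'
      exact mul_ne_zero (sub_ne_zero.2 (hz.1.2.ne hne)) (sub_ne_zero.2 (hz.2.2.ne hne))
    · have hne := (Finset.mem_Ioi.1 hk).ne'
      exact mul_ne_zero (rpow_sub_rpow_ne_zero hθ (h1 j) (h1 k) (hz.1.2.ne hne))
        (rpow_sub_rpow_ne_zero hθ (h2 j) (h2 k) (hz.2.2.ne hne))
  · refine (ae_restrict_mem (measurableSet_orthant_prod N)).mono fun z hz => ?_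
    have h1 := hz.1
    have h2 := hz.2
    simp only [Pi.zero_apply]
    rw [mul_assoc, div_mul_eq_mul_div, ← Finset.prod_mul_distrib]
    simp only [← Finset.prod_mul_distrib]
    refine mul_nonneg (Finset.prod_nonneg fun j _ => ?_) (div_nonneg (Finset.prod_nonneg
      fun j _ => Finset.prod_nonneg fun k _ => ?_) (Finset.prod_nonneg fun j _ =>
        Finset.prod_nonneg fun k _ => (add_pos (h1 j) (h2 k)).le))
    · have := Real.rpow_pos_of_pos (h1 j) a
      have := Real.rpow_pos_of_pos (h2 j) (a + 1)
      positivity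
    · rw [mul_mul_mul_comm]
      exact mul_nonneg (sub_mul_rpow_sub_nonneg hθ (h1 j) (h1 k))
        (sub_mul_rpow_sub_nonneg hθ (h2 j) (h2 k))
  · refine IntegrableOn.congr_fun ?_ (fun z hz => (cauchy_integrand_eq hz.1 hz.2).symm)
      (measurableSet_orthant_prod N)
    rw [IntegrableOn, restrict_orthant_prod]
    exact integrable_det_mul_det_mul_det (integrable_cauchyKernel_mul ha hθ)

end Cauchy

/-! ### Construction of the Bures polynomials. -/

variable {a θ : ℝ}

/-- The coefficients of the `θ`-Bures polynomials. -/
def thetaBuresCoeff (a θ : ℝ) (n : ℕ) (k : Fin (n + 1)) : ℝ :=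
  (-1) ^ (n + k : ℕ) * schurMoment halfLine (weightedMonomial a θ)
    (fun j : Fin n => (k.succAbove j : ℕ)) / buresPartition a θ n

/-- The `θ`-Bures polynomials, as averaged characteristic polynomials of the Bures ensemble. -/
def thetaBures (a θ : ℝ) (n : ℕ) : ℝ[X] :=
  ∑ k : Fin (n + 1), C (thetaBuresCoeff a θ n k) * X ^ (k : ℕ)

theorem coeff_thetaBures_self (ha : -1 < a) (hθ : 0 < θ) (n : ℕ) :
    (thetaBures a θ n).coeff n = 1 := by
  have hZ := (buresPartition_pos ha hθ n).ne'
  rw [thetaBures, finsetSum_coeff, Finset.sum_eq_single (Fin.last n)]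
  · have h : (fun j : Fin n => (((Fin.last n).succAbove j : Fin (n + 1)) : ℕ)) =
        fun j : Fin n => (j : ℕ) := by ext j; simp
    rw [Fin.val_last, coeff_C_mul_X_pow, if_pos rfl, thetaBuresCoeff, h,
      ← buresPartition_eq_schurMoment ha hθ, Fin.val_last, Even.neg_one_pow ⟨n, rfl⟩, one_mul,
      div_self hZ]
  · intro k _ hk
    rw [coeff_C_mul_X_pow, if_neg]
    intro h
    exact hk (Fin.ext (by simp [← h]))
  · simp

theorem degree_thetaBures_lt (n : ℕ) : (thetaBures a θ n).degree < (n + 1 : ℕ) := by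
  refine (degree_sum_le _ _).trans_lt ((Finset.sup_lt_iff (WithBot.bot_lt_coe _)).2 fun k _ => ?_)
  exact (degree_C_mul_X_pow_le _ _).trans_lt (by exact_mod_cast k.is_lt)

theorem natDegree_thetaBures (ha : -1 < a) (hθ : 0 < θ) (n : ℕ) :
    (thetaBures a θ n).natDegree = n := by
  refine le_antisymm ?_ (le_natDegree_of_ne_zero ?_)
  · exact natDegree_le_iff_degree_le.2 (Order.le_of_lt_succ (degree_thetaBures_lt n))
  · rw [coeff_thetaBures_self ha hθ]
    exact one_ne_zero

theorem monic_thetaBures (ha : -1 < a) (hθ : 0 < θ) (n : ℕ) : (thetaBures a θ n).Monic := by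
  rw [Monic, leadingCoeff, natDegree_thetaBures ha hθ, coeff_thetaBures_self ha hθ]

theorem momentFunctional_C_mul_X_pow (m : ℕ → ℝ) (c : ℝ) (k : ℕ) :
    momentFunctional m (C c * X ^ k) = c * m k := by
  rw [momentFunctional_eq_sum m (n := k + 1)
    ((natDegree_C_mul_X_pow_le c k).trans_lt k.lt_succ_self), Finset.sum_eq_single k]
  · simp
  · intro j _ hj
    rw [coeff_C_mul_X_pow, if_neg hj, zero_mul]
  · simp

theorem momentFunctional_thetaBures (m : ℕ → ℝ) (n : ℕ) :
    momentFunctional m (thetaBures a θ n) = ∑ k : Fin (n + 1), thetaBuresCoeff a θ n k * m k := by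
  simp only [thetaBures, map_sum, momentFunctional_C_mul_X_pow]

theorem buresMoment_eq (j : ℕ) : buresMoment a θ j = ∫ x, weightedMonomial a θ j x ∂halfLine := rfl

/-- The single moments of the `θ`-Bures polynomials. -/
theorem momentFunctional_buresMoment_thetaBures (ha : -1 < a) (hθ : 0 < θ) (n : ℕ) :
    momentFunctional (buresMoment a θ) (thetaBures a θ n) =
      if Even n then buresPartition a θ (n + 1) / buresPartition a θ n else 0 := by
  have h := sum_schurMoment_mul_integral ae_halfLine_pos (integrable_weightedMonomial ha hθ) n
  rw [← buresPartition_eq_schurMoment ha hθ] at h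
  rw [momentFunctional_thetaBures]
  simp only [thetaBuresCoeff, div_mul_eq_mul_div, ← Finset.sum_div, buresMoment_eq, h]
  split_ifs <;> simp

/-- The skew moments of the `θ`-Bures polynomials. -/
theorem momentFunctional_skew_thetaBures (ha : -1 < a) (hθ : 0 < θ) {n i : ℕ} (hi : i ≤ n + 1) :
    momentFunctional (fun k => buresSkewMoment a θ k i) (thetaBures a θ n) =
      ((if i = n + 1 then buresPartition a θ (n + 2) else 0) -
        if Even n then 0 else buresPartition a θ (n + 1) * buresMoment a θ i) /
      buresPartition a θ n := by
  have h := sum_schurMoment_mul_skewMoment ae_halfLine_pos (integrable_weightedMonomial ha hθ) n i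
  rw [← buresPartition_eq_schurMoment ha hθ, ← buresMoment_eq] at h
  rw [momentFunctional_thetaBures]
  simp only [thetaBuresCoeff, div_mul_eq_mul_div, ← Finset.sum_div, buresSkewMoment, h]
  congr 2
  split_ifs with hin
  -- For i = n + 1 the exponents are 0, …, n + 1, which gives Z_{n+2}.
  · rw [buresPartition_eq_schurMoment ha hθ]
    congr 1
    ext j
    split_ifs with hj
    · rfl
    · have := j.is_lt
      omega
  -- For i ≤ n the exponent i occurs twice, and antisymmetry makes the moment vanish.
  · have hlt : i < n + 1 := lt_of_le_of_ne hi hin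
    refine schurMoment_eq_zero (i := ⟨i, by omega⟩) (j := Fin.last (n + 1)) ?_ ?_
    · intro h
      exact hin (by simpa using congrArg Fin.val h)
    · simp [Nat.lt_succ_iff.1 hlt]

theorem isThetaBures_thetaBures (ha : -1 < a) (hθ : 0 < θ) :
    IsThetaBures a θ (thetaBures a θ) where
  monic := monic_thetaBures ha hθ
  natDegree_eq := natDegree_thetaBures ha hθ
  even n i hi := by
    rw [buresInner_X_pow ha hθ, momentFunctional_skew_thetaBures ha hθ hi,
      if_pos (even_two_mul n), sub_zero]
    split_ifs <;> simp
  odd n i hi := by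
    rw [buresInner_X_pow ha hθ, momentFunctional_skew_thetaBures ha hθ (by omega),
      if_neg (by omega), if_neg (by simp)]
    ring

/-! ### Nondegeneracy of the Bures form and uniqueness. -/

theorem momentFunctional_skew_swap {p q : ℝ[X]} :
    momentFunctional (fun i => momentFunctional (fun k => buresSkewMoment a θ k i) p) q =
      -momentFunctional (fun i => momentFunctional (fun k => buresSkewMoment a θ k i) q) p := by
  simp only [momentFunctional_eq_sum _ (Nat.lt_succ_self _), Finset.mul_sum]
  rw [Finset.sum_comm, ← Finset.sum_neg_distrib]
  refine Finset.sum_congr rfl fun j _ => ?_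
  rw [← Finset.sum_neg_distrib]
  refine Finset.sum_congr rfl fun k _ => ?_
  rw [buresSkewMoment_neg_swap j k]
  ring

/-- The Bures form is nondegenerate on polynomials of degree less than `2m`. -/
theorem eq_zero_of_forall_momentFunctional_skew_eq_zero (ha : -1 < a) (hθ : 0 < θ) (m : ℕ) :
    ∀ p : ℝ[X], p.degree < (2 * m : ℕ) →
      (∀ i < 2 * m, momentFunctional (fun k => buresSkewMoment a θ k i) p = 0) → p = 0 := by
  induction m with
  | zero =>
    intro p hp _
    exact degree_eq_bot.1 (Nat.WithBot.lt_zero_iff.1 (by simpa using hp))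
  | succ m ih =>
    intro p hp h
    set f := thetaBures a θ (2 * m)
    set r := buresPartition a θ (2 * m + 2) / buresPartition a θ (2 * m)
    have hr : r ≠ 0 :=
      (div_pos (buresPartition_pos ha hθ _) (buresPartition_pos ha hθ _)).ne'
    have hf : ∀ i ≤ 2 * m + 1, momentFunctional (fun k => buresSkewMoment a θ k i) f =
        if i = 2 * m + 1 then r else 0 := fun i hi => by
      rw [← buresInner_X_pow ha hθ]
      exact (isThetaBures_thetaBures ha hθ).even m i hi
    have hfd : f.natDegree = 2 * m := natDegree_thetaBures ha hθ _
    have hpd : p.natDegree < 2 * m + 2 := by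
      by_cases hp0 : p = 0
      · rw [hp0]; simp
      · exact (natDegree_lt_iff_degree_lt hp0).2 hp
    -- Pair p with f = φ_{2m} in both orders: one order vanishes by hypothesis, the other keeps only
    -- the top coefficient of p, times r.
    have h1 : p.coeff (2 * m + 1) = 0 := by
      have h2 := momentFunctional_skew_swap (a := a) (θ := θ) (p := p) (q := f)
      rw [momentFunctional_eq_sum _ (by omega : f.natDegree < 2 * m + 1),
        Finset.sum_eq_zero fun i hi => by
          rw [h i (by have := Finset.mem_range.1 hi; omega), mul_zero],
        momentFunctional_eq_sum _ hpd, Finset.sum_range_succ,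
        Finset.sum_eq_zero fun i hi => by
          have := Finset.mem_range.1 hi
          rw [hf i (by omega), if_neg (by omega), mul_zero],
        hf _ le_rfl, if_pos rfl, zero_add, zero_eq_neg] at h2
      exact (mul_eq_zero.1 h2).resolve_right hr
    -- Removing the multiple of f brings the degree below 2m, and f is orthogonal to all z^i with i
    -- ≤ 2m, so the induction hypothesis applies.
    have h3 : p - p.coeff (2 * m) • f = 0 := by
      refine ih _ ((degree_lt_iff_coeff_zero _ _).2 fun j hj => ?_) fun i hi => ?_
      · rw [coeff_sub, coeff_smul, smul_eq_mul]
        rcases hj.eq_or_lt with rfl | hj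
        · rw [coeff_thetaBures_self ha hθ, mul_one, sub_self]
        · rw [coeff_eq_zero_of_natDegree_lt (hfd.trans_lt hj), mul_zero, sub_zero]
          rcases (Nat.succ_le_of_lt hj).eq_or_lt with hj | hj
          · rw [← hj]; exact h1
          · exact coeff_eq_zero_of_natDegree_lt (by omega)
      · rw [map_sub, map_smul, h i (by omega), hf i (by omega), if_neg (by omega), smul_zero,
          sub_zero]
    have h4 : p = p.coeff (2 * m) • f := sub_eq_zero.1 h3
    -- The condition at i = 2m + 1, where f pairs to r ≠ 0, kills the remaining scalar.
    have h5 := h (2 * m + 1) (by omega)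
    rw [h4, map_smul, hf _ le_rfl, if_pos rfl, smul_eq_mul] at h5
    rw [h4, (mul_eq_zero.1 h5).resolve_right hr, zero_smul]

theorem degree_sub_lt_of_monic {p q : ℝ[X]} {n : ℕ} (hp : p.Monic) (hq : q.Monic)
    (hpn : p.natDegree = n) (hqn : q.natDegree = n) : (p - q).degree < (n : ℕ) := by
  have hp' : p.degree = (n : ℕ) := by rw [degree_eq_natDegree hp.ne_zero, hpn]
  have hq' : q.degree = (n : ℕ) := by rw [degree_eq_natDegree hq.ne_zero, hqn]
  rw [← hp']
  exact degree_sub_lt_left (hp'.trans hq'.symm) hp.ne_zero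
    (hp.leadingCoeff.trans hq.leadingCoeff.symm)

theorem IsThetaBures.eq_thetaBures (ha : -1 < a) (hθ : 0 < θ) {φ : ℕ → ℝ[X]}
    (hφ : IsThetaBures a θ φ) : φ = thetaBures a θ := by
  have hψ := isThetaBures_thetaBures ha hθ
  ext1 n
  have hd := degree_sub_lt_of_monic (hφ.monic n) (hψ.monic n) (hφ.natDegree_eq n)
    (hψ.natDegree_eq n)
  rw [← sub_eq_zero]
  obtain ⟨m, rfl | rfl⟩ := Nat.even_or_odd' n
  · refine eq_zero_of_forall_momentFunctional_skew_eq_zero ha hθ m _ hd fun i hi => ?_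
    rw [map_sub, ← buresInner_X_pow ha hθ, ← buresInner_X_pow ha hθ, hφ.even m i (by omega),
      hψ.even m i (by omega), sub_self]
  -- Nondegeneracy is available only in even dimension, so an odd index uses the space of degree
  -- less than 2m + 2; the orthogonality conditions reach i = 2m + 1 as needed.
  · refine eq_zero_of_forall_momentFunctional_skew_eq_zero ha hθ (m + 1) _
      (hd.trans (by exact_mod_cast (by omega : 2 * m + 1 < 2 * (m + 1)))) fun i hi => ?_
    rw [map_sub, ← buresInner_X_pow ha hθ, ← buresInner_X_pow ha hθ, hφ.odd m i (by omega),
      hψ.odd m i (by omega), sub_self]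

/-! ### The Cauchy polynomials through orthogonality. -/

/-- A determinant of moments bordered by powers of `X` is a multiple of any monic polynomial
annihilated by the corresponding moment functionals. -/
theorem det_moments_X_pow {m : ℕ → ℕ → ℝ} {n : ℕ} {p : ℝ[X]} (hp : p.coeff n = 1)
    (hd : p.natDegree < n + 1) (h : ∀ k < n, momentFunctional (fun j => m j k) p = 0) :
    (Matrix.of fun j k : Fin (n + 1) => if (k : ℕ) < n then C (m j k) else X ^ (j : ℕ)).det =
      C (Matrix.of fun j k : Fin n => m j k).det * p := by
  set A : Matrix (Fin (n + 1)) (Fin (n + 1)) ℝ[X] := Matrix.of fun j k =>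
    if (k : ℕ) < n then C (m j k) else X ^ (j : ℕ)
  set r : Fin (n + 1) → ℝ[X] := ∑ j : Fin (n + 1), C (p.coeff j) • A j with hr
  -- The last row is replaced by the combination of all rows with the coefficients of p. Its own
  -- coefficient is 1, so the determinant is unchanged; the new row is (0, …, 0, p) by
  -- orthogonality.
  have hrow := Matrix.det_updateRow_sum A (Fin.last n) fun j => C (p.coeff j)
  rw [Fin.val_last, hp, C_1, one_smul, ← hr] at hrow
  rw [← hrow, Matrix.det_succ_row _ (Fin.last n), Finset.sum_eq_single (Fin.last n)]
  · have h1 : (A.updateRow (Fin.last n) r).submatrix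
        (Fin.last n).succAbove (Fin.last n).succAbove = Matrix.of fun j k : Fin n => C (m j k) := by
      ext1 j k
      simp [A, Matrix.updateRow_apply, Fin.castSucc_ne_last]
    have h2 : r (Fin.last n) = p := by
      rw [hr, Finset.sum_apply]
      conv_rhs => rw [as_sum_range_C_mul_X_pow' p hd, Finset.sum_range]
      simp [A]
    have h3 : (Matrix.of fun j k : Fin n => C (m j k)).det =
        C (Matrix.of fun j k : Fin n => m j k).det := (RingHom.map_det _ _).symm
    rw [h1, Matrix.updateRow_self, h2, h3, Even.neg_one_pow ⟨_, rfl⟩, one_mul, mul_comm]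
  · intro k _ hk
    have hkn : (k : ℕ) < n := Fin.val_lt_last hk
    have h0 : r k = 0 := by
      rw [hr, Finset.sum_apply]
      simp only [A, Pi.smul_apply, Matrix.of_apply, if_pos hkn, smul_eq_mul, ← C_mul, ← map_sum]
      have := h k hkn
      rw [momentFunctional_eq_sum _ hd, Finset.sum_range] at this
      rw [this, C_0]
    rw [Matrix.updateRow_self, h0, mul_zero, zero_mul]
  · simp

/-- A monic polynomial orthogonal to lower powers is the first Cauchy polynomial. -/
theorem cauchyP_eq (ha : -1 < a) (hθ : 0 < θ) {n : ℕ} {p : ℝ[X]} (hp : p.coeff n = 1)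
    (hd : p.natDegree < n + 1)
    (h : ∀ k < n, momentFunctional (fun j => cauchyMoment a θ j k) p = 0) :
    cauchyP a θ n = p := by
  rw [cauchyP, det_moments_X_pow hp hd h, ← cauchyPartition_eq_det ha hθ, ← mul_assoc, ← C_mul,
    inv_mul_cancel₀ (cauchyPartition_pos ha hθ n).ne', C_1, one_mul]

/-- A monic polynomial orthogonal to lower powers is the second Cauchy polynomial. -/
theorem cauchyQ_eq (ha : -1 < a) (hθ : 0 < θ) {n : ℕ} {p : ℝ[X]} (hp : p.coeff n = 1)
    (hd : p.natDegree < n + 1)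
    (h : ∀ j < n, momentFunctional (fun k => cauchyMoment a θ j k) p = 0) :
    cauchyQ a θ n = p := by
  -- The second family is the first one for the transposed moments.
  have hdet := det_moments_X_pow (m := fun k j => cauchyMoment a θ j k) hp hd h
  rw [← Matrix.det_transpose, ← Matrix.det_transpose (Matrix.of fun j k : Fin n => _)] at hdet
  change _ = C (Matrix.of fun j k : Fin n => cauchyMoment a θ j k).det * p at hdet
  rw [← cauchyPartition_eq_det ha hθ] at hdet
  change C _ * Matrix.det (Matrix.transpose (Matrix.of fun j k : Fin (n + 1) =>
      if (k : ℕ) < n then C (cauchyMoment a θ k j) else X ^ (j : ℕ))) = p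
  rw [hdet, ← mul_assoc, ← C_mul, inv_mul_cancel₀ (cauchyPartition_pos ha hθ n).ne', C_1, one_mul]

theorem momentFunctional_cauchyMoment_left (ha : -1 < a) (hθ : 0 < θ) (p : ℝ[X]) (k : ℕ) :
    momentFunctional (fun j => cauchyMoment a θ j k) p =
      (momentFunctional (buresMoment a θ) p * buresMoment a θ k +
        momentFunctional (fun j => buresSkewMoment a θ j k) p) / 2 := by
  simp only [momentFunctional_eq_sum _ (Nat.lt_succ_self _)]
  rw [Finset.sum_mul, ← Finset.sum_add_distrib, Finset.sum_div]
  refine Finset.sum_congr rfl fun j _ => ?_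
  rw [cauchyMoment_eq ha hθ]
  ring

/-- Skew symmetry flips the sign of the second part; this is the only difference between P̃ and Q̃.
-/
theorem momentFunctional_cauchyMoment_right (ha : -1 < a) (hθ : 0 < θ) (p : ℝ[X]) (j : ℕ) :
    momentFunctional (fun k => cauchyMoment a θ j k) p =
      (momentFunctional (buresMoment a θ) p * buresMoment a θ j -
        momentFunctional (fun k => buresSkewMoment a θ k j) p) / 2 := by
  simp only [momentFunctional_eq_sum _ (Nat.lt_succ_self _)]
  rw [Finset.sum_mul, ← Finset.sum_sub_distrib, Finset.sum_div]
  refine Finset.sum_congr rfl fun k _ => ?_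
  rw [cauchyMoment_eq ha hθ, buresSkewMoment_neg_swap]
  ring

theorem coeff_thetaBures_succ (ha : -1 < a) (hθ : 0 < θ) (m : ℕ) :
    (thetaBures a θ m).coeff (m + 1) = 0 :=
  coeff_eq_zero_of_natDegree_lt ((natDegree_thetaBures ha hθ m).trans_lt m.lt_succ_self)

theorem natDegree_thetaBures_add_C_mul_lt (ha : -1 < a) (hθ : 0 < θ) (m : ℕ) (c : ℝ) :
    (thetaBures a θ (m + 1) + C c * thetaBures a θ m).natDegree < m + 1 + 1 := by
  refine Nat.lt_succ_of_le (natDegree_add_le_of_degree_le (natDegree_thetaBures ha hθ _).le ?_)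
  exact (natDegree_C_mul_le _ _).trans ((natDegree_thetaBures ha hθ m).le.trans m.le_succ)

/-- For k ≤ n, L(φ_n) i_k + ⟨φ_n, z^k⟩ = (-1)^n (Z_{n+1}/Z_n) i_k. The signs for n = m and n = m + 1
are opposite, and the constant is the ratio Z_{m+2}/Z_{m+1} : Z_{m+1}/Z_m, so the two contributions
cancel. -/
theorem cauchyP_succ (ha : -1 < a) (hθ : 0 < θ) (m : ℕ) :
    cauchyP a θ (m + 1) = thetaBures a θ (m + 1) + C (buresPartition a θ (m + 2) *
      buresPartition a θ m / buresPartition a θ (m + 1) ^ 2) * thetaBures a θ m := by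
  have h0 := (buresPartition_pos ha hθ m).ne'
  have h1 := (buresPartition_pos ha hθ (m + 1)).ne'
  refine cauchyP_eq ha hθ ?_ (natDegree_thetaBures_add_C_mul_lt ha hθ m _) fun k hk => ?_
  · rw [coeff_add, coeff_C_mul, coeff_thetaBures_self ha hθ, coeff_thetaBures_succ ha hθ]
    ring
  · rw [momentFunctional_cauchyMoment_left ha hθ, ← smul_eq_C_mul]
    simp only [map_add, map_smul, momentFunctional_buresMoment_thetaBures ha hθ,
      momentFunctional_skew_thetaBures ha hθ (by omega : k ≤ m + 1 + 1),
      momentFunctional_skew_thetaBures ha hθ (by omega : k ≤ m + 1), smul_eq_mul,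
      if_neg (by omega : ¬ k = m + 1 + 1), if_neg (by omega : ¬ k = m + 1), Nat.even_add_one]
    by_cases hm : Even m
    · simp only [hm, not_true_eq_false, if_true, if_false]
      field_simp
      ring
    · simp only [hm, not_false_eq_true, if_true, if_false]
      field_simp
      ring

/-- Here L(φ_n) i_k - ⟨φ_n, z^k⟩ = (Z_{n+1}/Z_n) i_k for both parities, so the correction is
subtracted. -/
theorem cauchyQ_succ (ha : -1 < a) (hθ : 0 < θ) (m : ℕ) :
    cauchyQ a θ (m + 1) = thetaBures a θ (m + 1) - C (buresPartition a θ (m + 2) *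
      buresPartition a θ m / buresPartition a θ (m + 1) ^ 2) * thetaBures a θ m := by
  have h0 := (buresPartition_pos ha hθ m).ne'
  have h1 := (buresPartition_pos ha hθ (m + 1)).ne'
  rw [sub_eq_add_neg, ← neg_mul, ← C_neg]
  refine cauchyQ_eq ha hθ ?_ (natDegree_thetaBures_add_C_mul_lt ha hθ m _) fun k hk => ?_
  · rw [coeff_add, coeff_C_mul, coeff_thetaBures_self ha hθ, coeff_thetaBures_succ ha hθ]
    ring
  · rw [momentFunctional_cauchyMoment_right ha hθ, ← smul_eq_C_mul]
    simp only [map_add, map_smul, momentFunctional_buresMoment_thetaBures ha hθ,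
      momentFunctional_skew_thetaBures ha hθ (by omega : k ≤ m + 1 + 1),
      momentFunctional_skew_thetaBures ha hθ (by omega : k ≤ m + 1), smul_eq_mul,
      if_neg (by omega : ¬ k = m + 1 + 1), if_neg (by omega : ¬ k = m + 1), Nat.even_add_one]
    by_cases hm : Even m
    · simp only [hm, not_true_eq_false, if_true, if_false]
      field_simp
      ring
    · simp only [hm, not_false_eq_true, if_true, if_false]
      field_simp
      ring

theorem thetaBures_zero (ha : -1 < a) (hθ : 0 < θ) : thetaBures a θ 0 = 1 :=
  (monic_thetaBures ha hθ 0).natDegree_eq_zero.1 (natDegree_thetaBures ha hθ 0)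

theorem cauchyP_zero (ha : -1 < a) (hθ : 0 < θ) : cauchyP a θ 0 = 1 :=
  cauchyP_eq ha hθ (by simp) (by simp) (by simp)

theorem cauchyQ_zero (ha : -1 < a) (hθ : 0 < θ) : cauchyQ a θ 0 = 1 :=
  cauchyQ_eq ha hθ (by simp) (by simp) (by simp)

end ThetaDeformed

end

theorem mainTheorem11 (a θ : ℝ) (ha : -1 < a) (hθ : 0 < θ) :
    (∃! φ : ℕ → ℝ[X], ThetaDeformed.IsThetaBures a θ φ) ∧
    ∀ φ : ℕ → ℝ[X], ThetaDeformed.IsThetaBures a θ φ →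
      (∀ n : ℕ,
        ThetaDeformed.cauchyP a θ n + ThetaDeformed.cauchyQ a θ n = 2 * φ n) ∧
      (∀ n : ℕ, 1 ≤ n →
        ThetaDeformed.cauchyQ a θ n =
          φ n - C (ThetaDeformed.buresPartition a θ (n + 1) *
            ThetaDeformed.buresPartition a θ (n - 1) /
              ThetaDeformed.buresPartition a θ n ^ 2) * φ (n - 1)) ∧
      (∀ n : ℕ, 1 ≤ n →
        ThetaDeformed.cauchyP a θ n =
          φ n + C (ThetaDeformed.buresPartition a θ (n + 1) *
            ThetaDeformed.buresPartition a θ (n - 1) /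
              ThetaDeformed.buresPartition a θ n ^ 2) * φ (n - 1)) := by
  refine ⟨⟨ThetaDeformed.thetaBures a θ, ThetaDeformed.isThetaBures_thetaBures ha hθ,
    fun φ hφ => hφ.eq_thetaBures ha hθ⟩, fun φ hφ => ?_⟩
  obtain rfl := hφ.eq_thetaBures ha hθ
  refine ⟨fun n => ?_, fun n hn => ?_, fun n hn => ?_⟩
  · cases n with
    | zero =>
      rw [ThetaDeformed.cauchyP_zero ha hθ, ThetaDeformed.cauchyQ_zero ha hθ,
        ThetaDeformed.thetaBures_zero ha hθ]
      ring
    | succ m =>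
      rw [ThetaDeformed.cauchyP_succ ha hθ, ThetaDeformed.cauchyQ_succ ha hθ]
      ring
  · obtain ⟨m, rfl⟩ := Nat.exists_eq_add_of_le' hn
    exact ThetaDeformed.cauchyQ_succ ha hθ m
  · obtain ⟨m, rfl⟩ := Nat.exists_eq_add_of_le' hn
    exact ThetaDeformed.cauchyP_succ ha hθ m
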